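/- **Setting.** Let $c>0$, $L_\mu,M_\mu\in\mathbb N$ and $C_\mu\in\mathbb R$. Let $d\ge1$, $N\ge2$, and let $\{X_h\}_{h\in[0,H]}$ be an $\mathbb R^d$-valued Gaussian process with mean function $\mu(h)=\mathbb E[X_h]$ and covariance function $\mathrm{Cov}(X_h,X_{h'})=\gamma(h,h')\Sigma$, where $\gamma(h,h')$ depends only on $|h-h'|$. Let $h_1<\dots<h_N$ be a uniform grid in $[0,H]$, $\Gamma=(\gamma(h_i,h_j))_{ij}$, and let $P_0$ be the law of $(X_{h_1},\dots,X_{h_N})\in\mathbb R^{dN}$. Put $\alpha_t=e^{-t/2}$, $\sigma_t=\sqrt{1-e^{-t}}$ and let $p_t(x)=\int (2\pi\sigma_t^2)^{-dN/2}\exp(-\|x-\alpha_tv\|_2^2/(2\sigma_t^2))\,P_0(dv)$, the density at time $t$ of the forward diffusion $dX_t=-\frac12X_tdt+dW_t$ started from $P_0$; the score is $\nabla\log p_t$. Let $\Phi_t=\alpha_t^2\,\Gamma\otimes\Sigma+\sigma_t^2 I$, $\kappa_t=\lambda_{\max}(\Phi_t)/\lambda_{\min}(\Phi_t)$ and $\eta_t=2/(\lambda_{\max}(\Phi_t)+\lambda_{\min}(\Phi_t))$.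 **Decay assumption.** There are time embeddings $e_1,\dots,e_N\in\mathbb R^{d_e}$ with $\|e_i\|_2=r$ and a positive, strictly increasing function $f$ (positive for positive arguments) with $\|e_i-e_j\|_2=f(|i-j|)\ge c|i-j|$, and $\gamma(h_i,h_j)=\exp(-\|e_i-e_j\|_2^\nu/\ell)$ with $\nu\in[1,2]$ and $\ell>0$. **Transformers.** A transformer block maps $Y\in\mathbb R^{D\times N}$ to $\mathrm{FFN}(\mathrm{Attn}(Y))$, with $\mathrm{Attn}(Y)=Y+\sum_m V^mY\,\mathrm{ReLU}((Q^mY)^\top K^mY)$ and $\mathrm{FFN}(Y)=Y+W_1\mathrm{ReLU}(W_2Y+b_2\mathbf 1^\top)+b_1\mathbf 1^\top$, all weight matrices being $D\times D$ and ReLU entrywise. $\mathcal T_{\rm raw}(D,L,M,B)$ is the set of compositions of $L$ blocks with at most $M$ heads each, in which the Frobenius norm of every weight matrix and the Euclidean norm of every offset vector is at most $B$. The encoder $f_{\rm in}$ maps patches $x_1,\dots,x_N\in\mathbb R^d$ and $t$ to the matrix with columns $y_i=[x_i^\top,e_i^\top,\phi(t)^\top,0_{5d}^\top,1,0_{3d}^\top]^\top$,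 $\phi(t)=(\eta_t,\alpha_t,\sigma_t^2,\alpha_t^2)$, so $D=9d+d_e+5$. The decoder $f_{\rm out}$ extracts the $d$ rows that follow $\phi(t)$, flattens them to a vector of $\mathbb R^{dN}$, and clips it radially to the Euclidean ball of radius $R_t$. $\mathcal T(D,L,M,B,R_t)$ is the set of functions $(x,t)\mapsto f_{\rm out}\circ g\circ f_{\rm in}$ with $g\in\mathcal T_{\rm raw}(D,L,M,B)$; the weights of $g$ do not depend on $t$. **Mean assumption** (for given $0<t_0\le T$). Some $f_\mu\in\mathcal T_{\rm raw}(9d+d_e+5,L_\mu,M_\mu,C_\mu d)$ maps, for all $x$ and all $t\in[t_0,T]$, the matrix with columns $[x_i^\top,e_i^\top,\phi(t)^\top,0_{5d}^\top,1,0_{3d}^\top]^\top$ to the matrix with columns $[x_i^\top,e_i^\top,\phi(t)^\top,0_{4d}^\top,\mu(h_i)^\top,1,0_{3d}^\top]^\top$. **Theorem.** Suppose the decay assumption holds with $\ell\le c^\nu$. Let $0<t_0\le T$, suppose the mean assumption holds, and let $0<\epsilon<\lambda_{\min}(\Gamma)$. Then there are $D,L,M,B,R_t$ (with $R_t\ge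 0$) and $\tilde s\in\mathcal T(D,L,M,B,R_t)$ such that $$\int\|\tilde s(x,t)-\nabla\log p_t(x)\|_2^2\,p_t(x)\,dx\le\sigma_t^{-2}\epsilon\quad\text{for all }t\in[t_0,T],$$ and, with a constant $C$ that depends only on $c,L_\mu,M_\mu,C_\mu$, $$D\le C(d+d_e),\qquad L\le C\,\kappa_{t_0}\log^2\!\Big(\frac{Nd}{\epsilon\sigma_{t_0}}\Big),\qquad M\le C\max\Big\{1,\Big(\ell\log^+\!\frac{Nd\|\Sigma\|_{\rm F}}{\epsilon\sigma_{t_0}}\Big)^{1/\nu}\Big\},$$ $$B\le C\log\!\Big(\frac{Nd}{\epsilon\sigma_{t_0}}\Big)\sigma_{t_0}^{-2}Nd\,(r^2+\|\Sigma\|_\infty),\qquad R_t\le C\log\!\Big(\frac{Nd}{\epsilon\sigma_{t_0}}\Big)\frac{\sqrt{Nd}}{\sigma_t}\quad(t\in[t_0,T]),$$ where $\|\Sigma\|_\infty=\max_{a,b}|\Sigma_{ab}|$ and $\log^+=\max(0,\log)$. -/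

import Mathlib

open MeasureTheory ProbabilityTheory
open scoped Kronecker Matrix

noncomputable section

namespace ScoreTransformer

/-! ### Matrix quantities -/

/-- Frobenius norm of a real matrix. -/
def frob {m n : Type*} [Fintype m] [Fintype n] (A : Matrix m n ℝ) : ℝ :=
  Real.sqrt (∑ i, ∑ j, A i j ^ 2)

/-- Euclidean norm of a real coordinate vector. -/
def euclNorm {n : Type*} [Fintype n] (b : n → ℝ) : ℝ :=
  Real.sqrt (∑ i, b i ^ 2)

/-- Largest absolute value of an entry. -/
def maxAbs {m n : Type*} (A : Matrix m n ℝ) : ℝ :=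
  ⨆ p : m × n, |A p.1 p.2|

/-- Largest eigenvalue (only used for real symmetric matrices of positive size). -/
def eigMax {n : Type*} [Fintype n] [DecidableEq n] (A : Matrix n n ℝ) : ℝ :=
  sSup (spectrum ℝ A)

/-- Smallest eigenvalue (only used for real symmetric matrices of positive size). -/
def eigMin {n : Type*} [Fintype n] [DecidableEq n] (A : Matrix n n ℝ) : ℝ :=
  sInf (spectrum ℝ A)

/-- Condition number of a positive definite matrix. -/
def condNumber {n : Type*} [Fintype n] [DecidableEq n] (A : Matrix n n ℝ) : ℝ :=
  eigMax A / eigMin A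

/-! ### Gaussian process data -/

/-- `X` is an `ℝᵈ`-valued Gaussian process on `[0, H]` with mean function `m` and covariance
function `(h, h') ↦ γ h h' • S`, where `γ` only depends on the gap between the time indices. -/
structure IsGPData {Ω : Type*} [MeasurableSpace Ω] (P : Measure Ω) {d : ℕ} {H : ℝ}
    (X : Set.Icc (0 : ℝ) H → Ω → EuclideanSpace ℝ (Fin d))
    (m : Set.Icc (0 : ℝ) H → EuclideanSpace ℝ (Fin d))
    (γ : Set.Icc (0 : ℝ) H → Set.Icc (0 : ℝ) H → ℝ)
    (S : Matrix (Fin d) (Fin d) ℝ) : Prop where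
  gaussian : IsGaussianProcess X P
  mean : ∀ h, ∫ ω, X h ω ∂P = m h
  covariance : ∀ h h' a b, cov[fun ω => X h ω a, fun ω => X h' ω b; P] = γ h h' * S a b
  gap : ∀ h₁ h₂ h₃ h₄ : Set.Icc (0 : ℝ) H,
    |(h₁ : ℝ) - h₂| = |(h₃ : ℝ) - h₄| → γ h₁ h₂ = γ h₃ h₄

/-- `h` is a uniform (equally spaced, increasing) grid. -/
def IsUniformGrid {H : ℝ} {N : ℕ} (h : Fin N → Set.Icc (0 : ℝ) H) : Prop :=
  ∃ a δ : ℝ, 0 < δ ∧ ∀ i : Fin N, (h i : ℝ) = a + (i : ℕ) * δ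

/-- The vector in `ℝᵈᴺ` that stacks the `N` observations of the process along the grid. -/
def stack {Ω : Type*} {d N : ℕ} {H : ℝ}
    (X : Set.Icc (0 : ℝ) H → Ω → EuclideanSpace ℝ (Fin d))
    (h : Fin N → Set.Icc (0 : ℝ) H) (ω : Ω) : EuclideanSpace ℝ (Fin N × Fin d) :=
  WithLp.toLp 2 fun p => X (h p.1) ω p.2

/-- The matrix `Γ` with entries `γ (h i) (h j)`. -/
def temporalMatrix {N : ℕ} {H : ℝ} (γ : Set.Icc (0 : ℝ) H → Set.Icc (0 : ℝ) H → ℝ)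
    (h : Fin N → Set.Icc (0 : ℝ) H) : Matrix (Fin N) (Fin N) ℝ :=
  Matrix.of fun i j => γ (h i) (h j)

/-- Time embeddings `e i` on the sphere of radius `r`, whose mutual distances are an increasing
function of `|i - j|` that grows at least like `c |i - j|`, and a covariance function that decays
exponentially in the `ν`-th power of these distances, with bandwidth `ℓ`. -/
structure DecayAssumption {N de : ℕ} {H : ℝ} (e : Fin N → EuclideanSpace ℝ (Fin de))
    (r c ν ℓ : ℝ) (γ : Set.Icc (0 : ℝ) H → Set.Icc (0 : ℝ) H → ℝ)
    (h : Fin N → Set.Icc (0 : ℝ) H) : Prop where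
  norm_eq : ∀ i, ‖e i‖ = r
  dist_eq : ∃ f : ℕ → ℝ, StrictMonoOn f (Set.Iio N) ∧
    (∀ n : ℕ, 0 < n → n < N → 0 < f n) ∧
    (∀ n : ℕ, n < N → c * n ≤ f n) ∧
    ∀ i j : Fin N, ‖e i - e j‖ = f (Nat.dist i j)
  exponent : 1 ≤ ν ∧ ν ≤ 2
  bandwidth : 0 < ℓ
  decay : ∀ i j, γ (h i) (h j) = Real.exp (-(‖e i - e j‖ ^ ν / ℓ))

/-! ### Forward diffusion and score -/

/-- `α_t = exp (-t/2)`. -/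
def alpha (t : ℝ) : ℝ := Real.exp (-t / 2)

/-- `σ_t = √(1 - exp (-t))`. -/
def sigma (t : ℝ) : ℝ := Real.sqrt (1 - Real.exp (-t))

/-- Density at diffusion time `t > 0` of the Ornstein-Uhlenbeck process
`dX_t = -½ X_t dt + dW_t` started from `X_0 ∼ P₀`: the mixture over `P₀` of its Gaussian
transition kernels `N(α_t v, σ_t² I)`. -/
def diffusedDensity {n : Type*} [Fintype n] (P₀ : Measure (EuclideanSpace ℝ n)) (t : ℝ)
    (x : EuclideanSpace ℝ n) : ℝ :=
  ∫ v, (2 * Real.pi * sigma t ^ 2) ^ (-(Fintype.card n : ℝ) / 2) *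
    Real.exp (-(‖x - alpha t • v‖ ^ 2 / (2 * sigma t ^ 2))) ∂P₀

/-- The score function `∇ log p_t`. -/
def score {n : Type*} [Fintype n] (P₀ : Measure (EuclideanSpace ℝ n)) (t : ℝ)
    (x : EuclideanSpace ℝ n) : EuclideanSpace ℝ n :=
  gradient (fun y => Real.log (diffusedDensity P₀ t y)) x

/-- The matrix `α_t² (Γ ⊗ Σ) + σ_t² I`. -/
def diffusedCov {N d : ℕ} (G : Matrix (Fin N) (Fin N) ℝ) (S : Matrix (Fin d) (Fin d) ℝ)
    (t : ℝ) : Matrix (Fin N × Fin d) (Fin N × Fin d) ℝ :=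
  alpha t ^ 2 • (G ⊗ₖ S) + sigma t ^ 2 • (1 : Matrix (Fin N × Fin d) (Fin N × Fin d) ℝ)

/-- The gradient descent step size `η_t = 2 / (λ_max + λ_min)` for the quadratic objective with
Hessian `α_t² (Γ ⊗ Σ) + σ_t² I`. -/
def stepSize {N d : ℕ} (G : Matrix (Fin N) (Fin N) ℝ) (S : Matrix (Fin d) (Fin d) ℝ)
    (t : ℝ) : ℝ :=
  2 / (eigMax (diffusedCov G S t) + eigMin (diffusedCov G S t))

/-- The diffusion time embedding `φ(t) = (η_t, α_t, σ_t², α_t²)`. -/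
def timeFeature {N d : ℕ} (G : Matrix (Fin N) (Fin N) ℝ) (S : Matrix (Fin d) (Fin d) ℝ)
    (t : ℝ) : Fin 4 → ℝ :=
  ![stepSize G S t, alpha t, sigma t ^ 2, alpha t ^ 2]

/-! ### Transformers -/

/-- The ReLU activation. -/
def relu (x : ℝ) : ℝ := max x 0

/-- Weights of one attention head acting on tokens with coordinates in `ι`. -/
structure Head (ι : Type) where
  V : Matrix ι ι ℝ
  Q : Matrix ι ι ℝ
  K : Matrix ι ι ℝ

/-- Weights of one transformer block: a multi-head attention layer and a feedforward layer. -/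
structure Block (ι : Type) where
  heads : List (Head ι)
  W₁ : Matrix ι ι ℝ
  W₂ : Matrix ι ι ℝ
  b₁ : ι → ℝ
  b₂ : ι → ℝ

variable {ι : Type} [Fintype ι] {N : ℕ}

/-- `V Y · ReLU((Q Y)ᵀ (K Y))`. -/
def Head.eval (a : Head ι) (Y : Matrix ι (Fin N) ℝ) : Matrix ι (Fin N) ℝ :=
  a.V * Y * ((a.Q * Y)ᵀ * (a.K * Y)).map relu

/-- `Y + ∑ₘ Vᵐ Y · ReLU((Qᵐ Y)ᵀ (Kᵐ Y))`. -/
def Block.attn (b : Block ι) (Y : Matrix ι (Fin N) ℝ) : Matrix ι (Fin N) ℝ :=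
  Y + (b.heads.map fun a => a.eval Y).sum

/-- `Y + W₁ · ReLU(W₂ Y + b₂ 1ᵀ) + b₁ 1ᵀ`. -/
def Block.ffn (b : Block ι) (Y : Matrix ι (Fin N) ℝ) : Matrix ι (Fin N) ℝ :=
  Y + b.W₁ * (b.W₂ * Y + Matrix.of fun k _ => b.b₂ k).map relu + Matrix.of fun k _ => b.b₁ k

/-- A transformer block is its attention layer followed by its feedforward layer. -/
def Block.eval (b : Block ι) (Y : Matrix ι (Fin N) ℝ) : Matrix ι (Fin N) ℝ :=
  b.ffn (b.attn Y)

/-- At most `M` heads; all weight matrices and offset vectors have norm at most `B`. -/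
structure Block.Bounded (b : Block ι) (M : ℕ) (B : ℝ) : Prop where
  heads_le : b.heads.length ≤ M
  head_le : ∀ a ∈ b.heads, frob a.V ≤ B ∧ frob a.Q ≤ B ∧ frob a.K ≤ B
  weight_le : frob b.W₁ ≤ B ∧ frob b.W₂ ≤ B
  offset_le : euclNorm b.b₁ ≤ B ∧ euclNorm b.b₂ ≤ B

/-- Successive application of the blocks, the first block of the list first. -/
def runBlocks (bs : List (Block ι)) (Y : Matrix ι (Fin N) ℝ) : Matrix ι (Fin N) ℝ :=
  bs.foldl (fun Z b => b.eval Z) Y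

/-- Raw transformers (no encoder or decoder) on `N` tokens with coordinates in `ι`: `L` blocks, at
most `M` heads in each, and weights bounded by `B`. -/
def RawTransformer (ι : Type) [Fintype ι] (N L M : ℕ) (B : ℝ) :
    Set (Matrix ι (Fin N) ℝ → Matrix ι (Fin N) ℝ) :=
  {g | ∃ bs : List (Block ι), bs.length = L ∧ (∀ b ∈ bs, b.Bounded M B) ∧ g = runBlocks bs}

/-- Coordinates of a token `[x, e, φ(t), five blocks of size d, 1, three blocks of size d]`. -/
abbrev Coord (d de : ℕ) : Type :=
  Fin d ⊕ Fin de ⊕ Fin 4 ⊕ (Fin 5 × Fin d) ⊕ Unit ⊕ (Fin 3 × Fin d)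

theorem card_coord (d de : ℕ) : Fintype.card (Coord d de) = 9 * d + de + 5 := by
  simp [Coord]
  ring

/-- The matrix whose `i`-th column is `[x i, e i, φ, u i, 1, 0]`. -/
def tokens {N d de : ℕ} (x : EuclideanSpace ℝ (Fin N × Fin d))
    (e : Fin N → EuclideanSpace ℝ (Fin de)) (φ : Fin 4 → ℝ)
    (u : Fin N → Fin 5 × Fin d → ℝ) : Matrix (Coord d de) (Fin N) ℝ :=
  Matrix.of fun k i =>
    Sum.elim (fun a => x (i, a))
      (Sum.elim (fun a => e i a)
        (Sum.elim φ
          (Sum.elim (u i)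
            (Sum.elim (fun _ => 1) (fun _ => 0))))) k

/-- The encoder `f_in`: every patch is lifted to `[x i, e i, φ, 0, 1, 0]`. -/
def encode {N d de : ℕ} (e : Fin N → EuclideanSpace ℝ (Fin de)) (φ : Fin 4 → ℝ)
    (x : EuclideanSpace ℝ (Fin N × Fin d)) : Matrix (Coord d de) (Fin N) ℝ :=
  tokens x e φ 0

/-- The linear part of the decoder: it extracts the rows right after those of `φ` (the first
buffer block) and flattens them. -/
def extract {N d de : ℕ} (Y : Matrix (Coord d de) (Fin N) ℝ) :
    EuclideanSpace ℝ (Fin N × Fin d) :=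
  WithLp.toLp 2 fun p => Y (Sum.inr (Sum.inr (Sum.inr (Sum.inl (0, p.2))))) p.1

open Classical in
/-- Clipping to the Euclidean ball of radius `R`. -/
def clip {n : Type*} [Fintype n] (R : ℝ) (s : EuclideanSpace ℝ n) : EuclideanSpace ℝ n :=
  if ‖s‖ ≤ R then s else (R / ‖s‖) • s

/-- The transformer architecture `T(D, L, M, B, R_t)`, with time embeddings `e` and diffusion time
embedding `φ`: functions of the diffusion time `t` and of the `N` patches `x`, with weights that
do not depend on `t`. -/
def Transformer {N d de : ℕ} (e : Fin N → EuclideanSpace ℝ (Fin de)) (φ : ℝ → Fin 4 → ℝ)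
    (D L M : ℕ) (B : ℝ) (R : ℝ → ℝ) :
    Set (ℝ → EuclideanSpace ℝ (Fin N × Fin d) → EuclideanSpace ℝ (Fin N × Fin d)) :=
  {s | D = Fintype.card (Coord d de) ∧ ∃ g ∈ RawTransformer (Coord d de) N L M B,
    ∀ t x, s t x = clip (R t) (extract (g (encode e (φ t) x)))}

/-- The mean vectors `μ i` of the patches are expressed by a raw transformer with `L` blocks, at
most `M` heads and weights bounded by `B`: for every diffusion time in `I` and every input it
writes `μ i` into the fifth buffer block and leaves everything else unchanged. -/
def MeanRepresentable {N d de : ℕ} (e : Fin N → EuclideanSpace ℝ (Fin de)) (φ : ℝ → Fin 4 → ℝ)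
    (μ : Fin N → EuclideanSpace ℝ (Fin d)) (I : Set ℝ) (L M : ℕ) (B : ℝ) : Prop :=
  ∃ g ∈ RawTransformer (Coord d de) N L M B,
    ∀ t ∈ I, ∀ x : EuclideanSpace ℝ (Fin N × Fin d),
      g (encode e (φ t) x) = tokens x e (φ t) fun i p => if p.1 = 4 then μ i p.2 else 0

end ScoreTransformer

end

/-!
# Transformers approximate the score of a Gaussian process

The observations form a Gaussian vector with mean `μ` and covariance `Γ ⊗ Σ`, so the diffused
density is Gaussian with covariance `Φ = α² (Γ ⊗ Σ) + σ² I` (`diffusedDensity_multivariateGaussian`, by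
completing the square) and the score at `x` is `-Φ⁻¹ z` with `z = x - α μ` (`score_eq`). This is the
minimiser of a quadratic objective with Hessian `Φ`, and the network runs gradient descent on that
objective: `s ↦ s - η (Φ s + z)`, with as many steps as the condition number times the logarithm of
the accuracy.

All operations of a step are done by attention heads whose queries and keys only see the time
embeddings, the time features and the constant coordinate (`Gate`, `Gate.head_eval`). A large
multiple of `⟪eᵢ, eⱼ⟫ - r²` in the score of a head suppresses all pairs `i ≠ j`; what remains is an
exact multiplication of each token by a time feature (`selfGate_update`). The matrix `Γ` is a
function of the inner product `⟪eᵢ, eⱼ⟫`, and since these inner products decrease strictly with the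
lag `|i - j|`, a sum of rectifiers that interpolates at the first `J` lags applies exactly the
matrix in which the lags beyond `J` are replaced by `J` (`interpolation`, `kernelBlocks_eval`). Each block
handles one lag: the number of heads stays constant, and a gradient step takes `J + 3` blocks. Since
`ℓ ≤ c ^ ν`, the truncation changes the entries of `Γ` by at most `exp (-J)`
(`DecayAssumption.exists_lag`), and `J` of the order of the logarithm is enough. The network is
therefore literally gradient descent for a perturbed Hessian (`descentBlocks_eval`).

The error analysis is relative to the quadratic form of `Φ`. An entrywise perturbation of `Γ` is
small relative to `Γ ≥ ε`, and tensoring with `Σ ≥ 0` preserves this, so that no bound on `Σ` is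
needed (`sq_dotProduct_perturbation_le`); descent then approaches the score with an error that is a
small multiple of `√(zᵀ Φ⁻¹ z) / σ` (`norm_descent_score_le`). Under the diffused law, moments and
exponential moments of `zᵀ Φ⁻¹ z` follow from a rescaling of space (`integral_exp_quad`); they bound
the mean squared error, including the part of the space where the clipping acts
(`integral_clip_sub_score_le`). Noising only improves the condition number
(`condNumber_antitone`), so that the number of steps can be chosen at the smallest time.
-/

noncomputable section

namespace ScoreTransformer

open Real
open scoped MatrixOrder

/-! ### The diffused Gaussian density and its score -/

lemma alpha_pos (t : ℝ) : 0 < alpha t := Real.exp_pos _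

lemma alpha_sq (t : ℝ) : alpha t ^ 2 = Real.exp (-t) := by
  rw [alpha, ← Real.exp_nat_mul]; congr 1; push_cast; ring

lemma sigma_sq {t : ℝ} (ht : 0 ≤ t) : sigma t ^ 2 = 1 - Real.exp (-t) :=
  Real.sq_sqrt (by simpa using ht)

lemma sigma_pos {t : ℝ} (ht : 0 < t) : 0 < sigma t :=
  Real.sqrt_pos.2 (by simpa using ht)

section Gaussian

variable {n : Type*} [Fintype n]

/-- The standard Gaussian measure has a density proportional to `exp (-‖x‖² / 2)`. -/
lemma exists_stdGaussian_integral :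
    ∃ Z : ℝ, 0 < Z ∧ ∀ f : EuclideanSpace ℝ n → ℝ,
      ∫ x, f x ∂stdGaussian (EuclideanSpace ℝ n) = ∫ x, Z * Real.exp (-(‖x‖ ^ 2 / 2)) * f x := by
  set E := EuclideanSpace ℝ n
  set k : ℝ := (Module.finrank ℝ E : ℝ) / 2
  set Z : ℝ := (2 * π) ^ (-k)
  have hZ : 0 < Z := by positivity
  have hint : Integrable fun x : E => Real.exp (-(‖x‖ ^ 2 / 2)) := by
    have h := (GaussianFourier.integrable_cexp_neg_mul_sq_norm_add (V := E) (b := (1 / 2 : ℂ))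
      (by norm_num) 0 0).re
    refine h.congr (Filter.Eventually.of_forall fun x => ?_)
    have : (-(1 / 2 : ℂ) * (‖x‖ : ℂ) ^ 2 + 0 * ((inner ℝ (0 : E) x : ℝ) : ℂ))
        = ((-(‖x‖ ^ 2 / 2) : ℝ) : ℂ) := by push_cast; ring
    simp only [this, ← Complex.ofReal_exp]
    exact Complex.ofReal_re _
  have hmeas : Measurable fun x : E => (Z * Real.exp (-(‖x‖ ^ 2 / 2))).toNNReal := by fun_prop
  have key : stdGaussian E =
      volume.withDensity fun x : E => ((Z * Real.exp (-(‖x‖ ^ 2 / 2))).toNNReal : ENNReal) := by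
    have hfin : IsFiniteMeasure
        (volume.withDensity fun x : E => ((Z * Real.exp (-(‖x‖ ^ 2 / 2))).toNNReal : ENNReal)) :=
      isFiniteMeasure_withDensity_ofReal (hint.const_mul Z).2
    apply Measure.ext_of_charFun
    ext ξ
    rw [charFun_stdGaussian, charFun_apply, integral_withDensity_eq_integral_smul hmeas]
    have h := GaussianFourier.integral_cexp_neg_mul_sq_norm_add (V := E) (b := (1 / 2 : ℂ))
      (by norm_num) Complex.I ξ
    have h2 : (fun x : E => (Z * Real.exp (-(‖x‖ ^ 2 / 2))).toNNReal •
          Complex.exp (((inner ℝ x ξ : ℝ) : ℂ) * Complex.I)) = fun x : E => (Z : ℂ) *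
          Complex.exp (-(1 / 2 : ℂ) * (‖x‖ : ℂ) ^ 2 + Complex.I * ((inner ℝ ξ x : ℝ) : ℂ)) := by
      ext x
      rw [NNReal.smul_def, Real.coe_toNNReal _ (by positivity), Complex.real_smul,
        Complex.exp_add, real_inner_comm]
      push_cast
      rw [mul_assoc, mul_comm Complex.I]
      congr 3
      ring
    rw [h2, integral_const_mul, h]
    have h3 : (π / (1 / 2 : ℂ)) = ((2 * π : ℝ) : ℂ) := by push_cast; ring
    have h4 : ((Module.finrank ℝ E : ℂ) / 2) = ((k : ℝ) : ℂ) := by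
      simp only [k]; push_cast; rfl
    rw [h3, h4, ← Complex.ofReal_cpow (by positivity), ← mul_assoc, ← Complex.ofReal_mul,
      ← Real.rpow_add (by positivity)]
    simp
    ring_nf
  refine ⟨Z, hZ, fun f => ?_⟩
  rw [key, integral_withDensity_eq_integral_smul hmeas]
  refine integral_congr_ae (Filter.Eventually.of_forall fun x => ?_)
  have h0 : 0 ≤ Z * Real.exp (-(‖x‖ ^ 2 / 2)) := by positivity
  simp only [NNReal.smul_def, Real.coe_toNNReal _ h0, smul_eq_mul]

/-- The Gaussian transition kernels integrate to one, hence so does the diffused density. -/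
lemma integral_diffusedDensity (P₀ : Measure (EuclideanSpace ℝ n)) [IsProbabilityMeasure P₀]
    {t : ℝ} (ht : 0 < t) :
    Integrable (diffusedDensity P₀ t) ∧ ∫ x, diffusedDensity P₀ t x = 1 := by
  have hσ := sigma_pos ht
  set c : ℝ := (2 * π * sigma t ^ 2) ^ (-(Fintype.card n : ℝ) / 2) with hc
  have hc0 : 0 < c := by positivity
  set F : EuclideanSpace ℝ n → EuclideanSpace ℝ n → ℝ := fun x v =>
    c * Real.exp (-(‖x - alpha t • v‖ ^ 2 / (2 * sigma t ^ 2))) with hF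
  have hFpos : ∀ x v, 0 ≤ F x v := fun x v => by simp only [hF]; positivity
  have hcen : ∫ x : EuclideanSpace ℝ n, c * Real.exp (-(1 / (2 * sigma t ^ 2)) * ‖x‖ ^ 2) = 1 := by
    rw [integral_const_mul, GaussianFourier.integral_rexp_neg_mul_sq_norm (by positivity)]
    have : π / (1 / (2 * sigma t ^ 2)) = 2 * π * sigma t ^ 2 := by field_simp
    rw [this, hc, finrank_euclideanSpace, ← Real.rpow_add (by positivity)]
    ring_nf
    simp
  have hker : ∀ v, Integrable (fun x => F x v) ∧ ∫ x, F x v = 1 := by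
    intro v
    have h0 : (fun x => F x v) = fun x => (fun y : EuclideanSpace ℝ n =>
        c * Real.exp (-(1 / (2 * sigma t ^ 2)) * ‖y‖ ^ 2)) (x - alpha t • v) := by
      ext x; simp only [hF]; congr 2; ring
    have hi : Integrable fun y : EuclideanSpace ℝ n =>
        c * Real.exp (-(1 / (2 * sigma t ^ 2)) * ‖y‖ ^ 2) :=
      Integrable.of_integral_ne_zero (by rw [hcen]; exact one_ne_zero)
    rw [h0]
    exact ⟨hi.comp_sub_right _, (integral_sub_right_eq_self (μ := volume) (fun y =>
        c * Real.exp (-(1 / (2 * sigma t ^ 2)) * ‖y‖ ^ 2)) (alpha t • v)).trans hcen⟩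
  have hcont : Continuous (Function.uncurry F) := by simp only [hF, Function.uncurry_def]; fun_prop
  have hprod : Integrable (Function.uncurry F) (volume.prod P₀) := by
    rw [integrable_prod_iff' hcont.aestronglyMeasurable]
    refine ⟨Filter.Eventually.of_forall fun v => (hker v).1, ?_⟩
    have : (fun v => ∫ x, ‖Function.uncurry F (x, v)‖) = fun _ => (1 : ℝ) := by
      ext v
      rw [← (hker v).2]
      exact integral_congr_ae (Filter.Eventually.of_forall fun x => by
        simp [Function.uncurry, abs_of_nonneg (hFpos x v)])
    rw [this]
    exact integrable_const _
  refine ⟨hprod.integral_prod_left, ?_⟩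
  change ∫ x, ∫ v, F x v ∂P₀ = 1
  rw [integral_integral_swap hprod]
  simp [(hker _).2]

/-- Exponential moments of a quadratic form `q` under the density `K exp (-q / 2)`: they only
require the normalising constant and a rescaling of the space. -/
lemma integral_exp_quad {q : EuclideanSpace ℝ n → ℝ}
    (hq : ∀ (c : ℝ) x, q (c • x) = c ^ 2 * q x)
    {p : EuclideanSpace ℝ n → ℝ} {K : ℝ} {b : EuclideanSpace ℝ n}
    (hp : ∀ x, p x = K * Real.exp (-(q (x - b) / 2))) (hint : Integrable p) (h1 : ∫ x, p x = 1)
    {a : ℝ} (ha : a < 1 / 2) :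
    Integrable (fun x => Real.exp (a * q (x - b)) * p x) ∧
      ∫ x, Real.exp (a * q (x - b)) * p x = (Real.sqrt (1 - 2 * a) ^ Fintype.card n)⁻¹ := by
  set s := Real.sqrt (1 - 2 * a) with hs
  have hs0 : 0 < s := Real.sqrt_pos.2 (by linarith)
  have hs2 : s ^ 2 = 1 - 2 * a := Real.sq_sqrt (by linarith)
  set g : EuclideanSpace ℝ n → ℝ := fun z => K * Real.exp (-(q z / 2)) with hg
  have hpg : p = fun x => g (x - b) := by ext x; rw [hp]
  have hgint : Integrable g := by
    have := hint.comp_add_right b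
    simpa [hpg] using this
  have hg1 : ∫ x, g x = 1 := by
    rw [← h1, hpg, integral_sub_right_eq_self]
  have h2 : (fun x => Real.exp (a * q (x - b)) * p x) = fun x => (fun z => g (s • z)) (x - b) := by
    ext x
    simp only [hg, hp, hq, hs2]
    rw [mul_left_comm, ← Real.exp_add]
    congr 2
    ring
  rw [h2]
  have h3 : Integrable fun z => g (s • z) := hgint.comp_smul hs0.ne'
  refine ⟨h3.comp_sub_right b, ?_⟩
  rw [integral_sub_right_eq_self (μ := volume) (fun z => g (s • z)) b,
    Measure.integral_comp_smul, hg1, finrank_euclideanSpace, abs_of_pos (by positivity)]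
  simp

/-- Under a density `K exp (-q / 2)` on an `n`-dimensional space, `q` has mean at most `8 n` and
`exp (q / 4)` has mean at most `2 ^ (n / 2)`. -/
lemma integral_quad_le {q : EuclideanSpace ℝ n → ℝ} (hq : ∀ (c : ℝ) x, q (c • x) = c ^ 2 * q x)
    (hq0 : ∀ x, 0 ≤ q x) (hqm : Continuous q)
    {p : EuclideanSpace ℝ n → ℝ} {K : ℝ} {b : EuclideanSpace ℝ n} (hK : 0 < K)
    (hp : ∀ x, p x = K * Real.exp (-(q (x - b) / 2))) (hint : Integrable p) (h1 : ∫ x, p x = 1)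
    (hn : 1 ≤ Fintype.card n) :
    (Integrable (fun x => q (x - b) * p x) ∧ ∫ x, q (x - b) * p x ≤ 8 * Fintype.card n) ∧
    (Integrable (fun x => Real.exp (q (x - b) / 4) * p x) ∧
      ∫ x, Real.exp (q (x - b) / 4) * p x ≤ Real.exp (Fintype.card n / 2)) := by
  have hn' : (1 : ℝ) ≤ Fintype.card n := by exact_mod_cast hn
  set N := Fintype.card n with hN
  have hp0 : ∀ x, 0 ≤ p x := fun x => by rw [hp]; positivity
  constructor
  · -- `q ≤ 4 n exp (q / (4 n))`, and the exponential moment of order `1 / (4 n)` is bounded.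
    have ha : (1 : ℝ) / (4 * N) < 1 / 2 := by
      rw [div_lt_div_iff₀ (by positivity) (by norm_num)]; linarith
    obtain ⟨hi, he⟩ := integral_exp_quad hq hp hint h1 ha
    have hle : ∀ x, q (x - b) * p x ≤ 4 * N * (Real.exp (1 / (4 * N) * q (x - b)) * p x) := by
      intro x
      rw [← mul_assoc]
      refine mul_le_mul_of_nonneg_right ?_ (hp0 x)
      have := Real.add_one_le_exp (1 / (4 * N) * q (x - b))
      calc q (x - b) = 4 * N * (1 / (4 * N) * q (x - b)) := by field_simp
        _ ≤ _ := by gcongr; linarith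
    have hcp : Continuous p := by
      have : p = fun x => K * Real.exp (-(q (x - b) / 2)) := funext hp
      rw [this]; fun_prop
    have hi' : Integrable (fun x => q (x - b) * p x) := by
      refine (hi.const_mul (4 * N : ℝ)).mono' (by fun_prop)
        (Filter.Eventually.of_forall fun x => ?_)
      rw [Real.norm_of_nonneg (mul_nonneg (hq0 _) (hp0 x))]
      exact hle x
    refine ⟨hi', (integral_mono hi' (hi.const_mul (4 * N : ℝ)) hle).trans ?_⟩
    rw [integral_const_mul, he]
    set s := Real.sqrt (1 - 2 * (1 / (4 * N) : ℝ))
    have hs2 : s ^ 2 = 1 - 1 / (2 * N) := by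
      rw [Real.sq_sqrt (by linarith)]; field_simp; ring
    have hs0 : 0 < s := Real.sqrt_pos.2 (by linarith)
    have h3 : 1 / 2 ≤ (s ^ N) ^ 2 := by
      rw [← pow_mul, mul_comm, pow_mul, hs2]
      have h4 : (-2 : ℝ) ≤ -(1 / (2 * N)) := by
        have : (1 : ℝ) / (2 * N) ≤ 2 := by
          rw [div_le_iff₀ (by positivity)]; linarith
        linarith
      have := one_add_mul_le_pow h4 N
      calc (1 / 2 : ℝ) = 1 + N * -(1 / (2 * N)) := by field_simp; ring
        _ ≤ _ := by rw [sub_eq_add_neg]; exact this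
    have h5 : 1 / 2 ≤ s ^ N := by
      have : 0 < s ^ N := by positivity
      nlinarith
    have h6 : (s ^ N)⁻¹ ≤ 2 := by
      rw [inv_le_comm₀ (by positivity) (by norm_num)]; linarith
    nlinarith
  · obtain ⟨hi, he⟩ := integral_exp_quad hq hp hint h1 (a := 1 / 4) (by norm_num)
    have h2 : (fun x => Real.exp (q (x - b) / 4) * p x) =
        fun x => Real.exp (1 / 4 * q (x - b)) * p x := by
      ext x; congr 2; ring
    rw [h2]
    refine ⟨hi, he.le.trans ?_⟩
    set s := Real.sqrt (1 - 2 * (1 / 4 : ℝ))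
    have hs2 : s ^ 2 = 1 / 2 := by
      rw [Real.sq_sqrt (by norm_num)]; norm_num
    have hs0 : 0 < s := Real.sqrt_pos.2 (by norm_num)
    have h3 : s⁻¹ ≤ Real.exp (1 / 2) := by
      have h4 : (s⁻¹) ^ 2 ≤ Real.exp (1 / 2) ^ 2 := by
        rw [inv_pow, hs2, ← Real.exp_nat_mul]
        have := Real.add_one_le_exp (1 : ℝ)
        norm_num at this ⊢
        linarith
      exact (pow_le_pow_iff_left₀ (by positivity) (by positivity) two_ne_zero).1 h4
    calc (s ^ N)⁻¹ = s⁻¹ ^ N := by rw [inv_pow]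
      _ ≤ Real.exp (1 / 2) ^ N := by gcongr
      _ = _ := by rw [← Real.exp_nat_mul]; congr 1; ring

variable [DecidableEq n]

/-- Completing the square in the latent Gaussian variable `g`: with `z = (α² L² + σ²) y`, the
exponent `‖z - α L g‖² / σ² + ‖g‖²` has minimiser `α L y` and minimum `⟪z, y⟫`. -/
lemma completing_square {E : Type*} [NormedAddCommGroup E] [InnerProductSpace ℝ E]
    (L : E →ₗ[ℝ] E) (hL : L.IsSymmetric) {α σ : ℝ} (hσ : σ ≠ 0) (y z h : E)
    (hz : z = α ^ 2 • L (L y) + σ ^ 2 • y) :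
    ‖z - α • L (α • L y + h)‖ ^ 2 / σ ^ 2 + ‖α • L y + h‖ ^ 2
      = inner ℝ z y + (‖α • L h‖ ^ 2 / σ ^ 2 + ‖h‖ ^ 2) := by
  have h1 : z - α • L (α • L y + h) = σ ^ 2 • y - α • L h := by
    rw [hz, map_add, map_smul]
    module
  have h2 : inner ℝ (L (L y)) y = ‖L y‖ ^ 2 := by
    rw [hL (L y) y, real_inner_self_eq_norm_sq]
  have h3 : inner ℝ y (L h) = inner ℝ (L y) h := (hL y h).symm
  rw [h1, norm_sub_sq_real, norm_add_sq_real, hz, inner_add_left, real_inner_smul_left,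
    real_inner_smul_left, real_inner_smul_left, real_inner_smul_left, real_inner_smul_right,
    norm_smul, norm_smul, norm_smul, h2, h3, real_inner_self_eq_norm_sq]
  simp only [mul_pow, Real.norm_eq_abs, sq_abs, abs_pow]
  field_simp
  ring

/-- The density of the diffused Gaussian is a Gaussian with covariance `α² G + σ² I`. -/
lemma diffusedDensity_multivariateGaussian (m : EuclideanSpace ℝ n) {G : Matrix n n ℝ}
    (hG : G.PosSemidef) {t : ℝ} (ht : 0 < t) :
    ∃ K : ℝ, 0 < K ∧ ∀ x, diffusedDensity (multivariateGaussian m G) t x =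
      K * Real.exp (-(inner ℝ (x - alpha t • m) (Matrix.toEuclideanCLM (𝕜 := ℝ)
        (alpha t ^ 2 • G + sigma t ^ 2 • (1 : Matrix n n ℝ))⁻¹ (x - alpha t • m)) / 2)) := by
  have hσ := sigma_pos ht
  obtain ⟨Z, hZ, hstd⟩ := exists_stdGaussian_integral (n := n)
  set L := Matrix.toEuclideanCLM (𝕜 := ℝ) (CFC.sqrt G) with hL
  have hLL : ∀ y, L (L y) = Matrix.toEuclideanCLM (𝕜 := ℝ) G y := by
    intro y
    rw [hL, ← ContinuousLinearMap.comp_apply, ← ContinuousLinearMap.mul_def, ← map_mul,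
      CFC.sqrt_mul_sqrt_self _ hG.nonneg]
  have hsym : (L : EuclideanSpace ℝ n →ₗ[ℝ] EuclideanSpace ℝ n).IsSymmetric := by
    have h1 : IsSelfAdjoint L := (CFC.sqrt_nonneg G).isSelfAdjoint.map _
    exact h1.isSymmetric
  set Φ := alpha t ^ 2 • G + sigma t ^ 2 • (1 : Matrix n n ℝ) with hΦ
  have hΦpos : Φ.PosDef := by
    refine Matrix.PosDef.posSemidef_add (hG.smul (by positivity)) ?_
    exact Matrix.PosDef.one.smul (by positivity)
  set c : ℝ := (2 * π * sigma t ^ 2) ^ (-(Fintype.card n : ℝ) / 2) with hc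
  set K : ℝ := ∫ h : EuclideanSpace ℝ n, Z * c *
    Real.exp (-((‖alpha t • L h‖ ^ 2 / sigma t ^ 2 + ‖h‖ ^ 2) / 2)) with hK
  have hmain : ∀ x, diffusedDensity (multivariateGaussian m G) t x =
      K * Real.exp (-(inner ℝ (x - alpha t • m) (Matrix.toEuclideanCLM (𝕜 := ℝ)
        Φ⁻¹ (x - alpha t • m)) / 2)) := by
    intro x
    set z := x - alpha t • m with hz
    set y := Matrix.toEuclideanCLM (𝕜 := ℝ) Φ⁻¹ z with hy
    have hzy : z = alpha t ^ 2 • L (L y) + sigma t ^ 2 • y := by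
      have h1 : Matrix.toEuclideanCLM (𝕜 := ℝ) Φ y = z := by
        rw [hy, ← ContinuousLinearMap.comp_apply, ← ContinuousLinearMap.mul_def, ← map_mul,
          Matrix.mul_nonsing_inv _ ((Matrix.isUnit_iff_isUnit_det _).1 hΦpos.isUnit), map_one]
        rfl
      rw [← h1, hΦ, map_add, map_smul, map_smul, map_one, hLL]
      rfl
    rw [diffusedDensity, multivariateGaussian, integral_map (by fun_prop)
      (Continuous.aestronglyMeasurable (by fun_prop)), hstd,
      ← integral_add_left_eq_self _ (alpha t • L y), hK, ← integral_mul_const]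
    refine integral_congr_ae (Filter.Eventually.of_forall fun h => ?_)
    have h2 : x - alpha t • (m + L (alpha t • L y + h)) = z - alpha t • L (alpha t • L y + h) := by
      rw [hz]; module
    have h3 := completing_square _ hsym hσ.ne' y z h hzy
    simp only [ContinuousLinearMap.coe_coe] at h3
    simp only [← hL, ← hc, h2]
    rw [mul_assoc (Z * c), ← Real.exp_add]
    have h4 : -((‖alpha t • L h‖ ^ 2 / sigma t ^ 2 + ‖h‖ ^ 2) / 2) + -(inner ℝ z y / 2)
        = -(‖alpha t • L y + h‖ ^ 2 / 2) +
          -(‖z - alpha t • L (alpha t • L y + h)‖ ^ 2 / (2 * sigma t ^ 2)) := by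
      have h5 : ‖z - alpha t • L (alpha t • L y + h)‖ ^ 2 / (2 * sigma t ^ 2)
        = ‖z - alpha t • L (alpha t • L y + h)‖ ^ 2 / sigma t ^ 2 / 2 := by field_simp
      rw [h5]
      linarith
    rw [h4, Real.exp_add]
    ring
  refine ⟨K, ?_, hmain⟩
  -- A vanishing constant would contradict that the density integrates to one.
  have hK0 : 0 ≤ K := integral_nonneg fun h => by positivity
  refine lt_of_le_of_ne hK0 fun h0 => ?_
  have h1 := (integral_diffusedDensity (multivariateGaussian m G) ht).2
  simp [hmain, ← h0] at h1

/-- The score of a Gaussian density is linear. -/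
lemma score_eq {P₀ : Measure (EuclideanSpace ℝ n)} {t K : ℝ} (hK : 0 < K)
    {b : EuclideanSpace ℝ n} {M : Matrix n n ℝ} (hM : M.IsHermitian)
    (hp : ∀ x, diffusedDensity P₀ t x =
      K * Real.exp (-(inner ℝ (x - b) (Matrix.toEuclideanCLM (𝕜 := ℝ) M (x - b)) / 2)))
    (x : EuclideanSpace ℝ n) :
    score P₀ t x = -Matrix.toEuclideanCLM (𝕜 := ℝ) M (x - b) := by
  set L := Matrix.toEuclideanCLM (𝕜 := ℝ) M
  have hsym : ∀ u v, inner ℝ (L u) v = inner ℝ u (L v) := by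
    have h1 : IsSelfAdjoint L := IsSelfAdjoint.map (f := Matrix.toEuclideanCLM (𝕜 := ℝ)) hM
    exact h1.isSymmetric
  have hlog : (fun y => Real.log (diffusedDensity P₀ t y)) =
      fun y => Real.log K - inner ℝ (y - b) (L (y - b)) / 2 := by
    ext y
    rw [hp, Real.log_mul hK.ne' (Real.exp_pos _).ne', Real.log_exp]
    ring
  rw [score, hlog]
  apply HasGradientAt.gradient
  rw [hasGradientAt_iff_hasFDerivAt]
  have h1 : HasFDerivAt (fun y : EuclideanSpace ℝ n => y - b) (ContinuousLinearMap.id ℝ _) x :=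
    (hasFDerivAt_id x).sub_const b
  have h2 : HasFDerivAt (fun y : EuclideanSpace ℝ n => L (y - b)) L x := by
    have h := HasFDerivAt.comp x (L.hasFDerivAt (x := x - b)) h1
    rwa [ContinuousLinearMap.comp_id] at h
  have h3 := ((h1.inner ℝ h2).mul_const (1 / 2 : ℝ)).const_sub (Real.log K)
  refine (h3.congr_fderiv ?_).congr_of_eventuallyEq (Filter.Eventually.of_forall fun y => ?_)
  · ext v
    simp [fderivInnerCLM_apply, ← hsym, real_inner_comm v]
    rw [← map_sub, ← hsym, inner_sub_right]
    ring
  · simp only; ring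

end Gaussian

/-! ### The law of the observations -/

section Law

variable {Ω : Type*} [MeasurableSpace Ω] {P : Measure Ω}

lemma posSemidef_covariance {κ : Type*} [Fintype κ] [IsFiniteMeasure P] {Y : κ → Ω → ℝ}
    (hY : ∀ i, MemLp (Y i) 2 P) : (Matrix.of fun i j => cov[Y i, Y j; P]).PosSemidef := by
  refine Matrix.PosSemidef.of_dotProduct_mulVec_nonneg ?_ fun x => ?_
  · ext i j
    simp [covariance_comm (Y i)]
  · have h1 := covarianceBilin_apply_pi hY (WithLp.toLp 2 x) (WithLp.toLp 2 x)
    have h2 := (isPosSemidef_covarianceBilin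
      (μ := P.map fun ω => WithLp.toLp 2 fun i => Y i ω)).nonneg (WithLp.toLp 2 x)
    have h3 : star x ⬝ᵥ (Matrix.of fun i j => cov[Y i, Y j; P]) *ᵥ x =
        ∑ i, ∑ j, x i * x j * cov[Y i, Y j; P] := by
      simp only [dotProduct, Matrix.mulVec, Finset.mul_sum, Matrix.of_apply, Pi.star_apply,
        star_trivial]
      exact Finset.sum_congr rfl fun i _ => Finset.sum_congr rfl fun j _ => by ring
    rw [h3, ← h1]
    exact h2

variable {d N : ℕ} {H : ℝ} {X : Set.Icc (0 : ℝ) H → Ω → EuclideanSpace ℝ (Fin d)}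
  {m : Set.Icc (0 : ℝ) H → EuclideanSpace ℝ (Fin d)}
  {γ : Set.Icc (0 : ℝ) H → Set.Icc (0 : ℝ) H → ℝ} {S : Matrix (Fin d) (Fin d) ℝ}

lemma IsGPData.memLp (hX : IsGPData P X m γ S) (h : Set.Icc (0 : ℝ) H) (a : Fin d) :
    MemLp (fun ω => X h ω a) 2 P :=
  ((hX.gaussian.hasGaussianLaw_eval h).map_fun (EuclideanSpace.proj a)).memLp_two

/-- The spatial covariance is a covariance matrix, since `γ h h = 1`. -/
lemma IsGPData.posSemidef_spatial (hX : IsGPData P X m γ S) (h : Set.Icc (0 : ℝ) H)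
    (h1 : γ h h = 1) : S.PosSemidef := by
  have := hX.gaussian.isProbabilityMeasure
  have h2 := posSemidef_covariance (hX.memLp h)
  have h3 : S = Matrix.of fun a b => cov[fun ω => X h ω a, fun ω => X h ω b; P] := by
    ext a b; simp [hX.covariance, h1]
  rwa [← h3] at h2

lemma IsGPData.posSemidef_kronecker (hX : IsGPData P X m γ S) (h : Fin N → Set.Icc (0 : ℝ) H) :
    (temporalMatrix γ h ⊗ₖ S).PosSemidef := by
  have := hX.gaussian.isProbabilityMeasure
  have h2 := posSemidef_covariance fun p : Fin N × Fin d => hX.memLp (h p.1) p.2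
  have h3 : temporalMatrix γ h ⊗ₖ S = Matrix.of fun p q : Fin N × Fin d =>
      cov[fun ω => X (h p.1) ω p.2, fun ω => X (h q.1) ω q.2; P] := by
    ext p q; simp [hX.covariance, temporalMatrix]
  rwa [← h3] at h2

/-- The observations along the grid form a Gaussian vector with mean `m (h i)` and covariance
`Γ ⊗ Σ`. -/
lemma IsGPData.map_stack (hX : IsGPData P X m γ S) (h : Fin N → Set.Icc (0 : ℝ) H) :
    P.map (stack X h) = multivariateGaussian
      (WithLp.toLp 2 fun p : Fin N × Fin d => m (h p.1) p.2) (temporalMatrix γ h ⊗ₖ S) := by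
  classical
  have hP := hX.gaussian.isProbabilityMeasure
  have hlaw : HasGaussianLaw (stack X h) P := by
    set I : Finset (Set.Icc (0 : ℝ) H) := Finset.univ.image h with hI
    have h1 := hX.gaussian.hasGaussianLaw I
    have hmem : ∀ i, h i ∈ I := fun i => Finset.mem_image_of_mem _ (Finset.mem_univ i)
    let L₀ : (I → EuclideanSpace ℝ (Fin d)) →ₗ[ℝ] EuclideanSpace ℝ (Fin N × Fin d) :=
      { toFun := fun v => WithLp.toLp 2 fun p => v ⟨h p.1, hmem p.1⟩ p.2
        map_add' := fun _ _ => rfl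
        map_smul' := fun _ _ => rfl }
    exact h1.map_fun (LinearMap.toContinuousLinearMap L₀)
  have hG := hlaw.isGaussian_map
  have hpos := hX.posSemidef_kronecker h
  have hmem : ∀ p : Fin N × Fin d, MemLp (fun ω => X (h p.1) ω p.2) 2 P :=
    fun p => hX.memLp (h p.1) p.2
  apply IsGaussian.ext
  · simp only [id_eq]
    rw [integral_id_multivariateGaussian, integral_map hlaw.aemeasurable (by fun_prop)]
    ext p
    have h1 := (EuclideanSpace.proj (𝕜 := ℝ) p).integral_comp_comm hlaw.integrable
    have h2 := (EuclideanSpace.proj (𝕜 := ℝ) p.2).integral_comp_comm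
      (hX.gaussian.hasGaussianLaw_eval (h p.1)).integrable
    simp only [EuclideanSpace.coe_proj] at h1 h2
    rw [hX.mean (h p.1)] at h2
    rw [← h1]
    exact h2
  · ext x y
    rw [covarianceBilin_multivariateGaussian hpos]
    have h1 := covarianceBilin_apply_pi hmem x y
    change covarianceBilin (P.map (stack X h)) x y = _ at h1
    rw [h1]
    simp only [dotProduct, Matrix.mulVec, Finset.mul_sum, hX.covariance, temporalMatrix,
      Matrix.kroneckerMap_apply, Matrix.of_apply]
    exact Finset.sum_congr rfl fun i _ => Finset.sum_congr rfl fun j _ => by ring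

end Law

/-! ### Extreme eigenvalues and the condition number -/

section Spectral

variable {n : Type*} [Fintype n] [DecidableEq n]

lemma eigMin_le_of_mem {A : Matrix n n ℝ} (hA : A.IsHermitian) {x : ℝ} (hx : x ∈ spectrum ℝ A) :
    eigMin A ≤ x :=
  csInf_le (hA.spectrum_real_eq_range_eigenvalues ▸ Set.finite_range _).bddBelow hx

lemma le_eigMax_of_mem {A : Matrix n n ℝ} (hA : A.IsHermitian) {x : ℝ} (hx : x ∈ spectrum ℝ A) :
    x ≤ eigMax A :=
  le_csSup (hA.spectrum_real_eq_range_eigenvalues ▸ Set.finite_range _).bddAbove hx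

lemma spectrum_nonempty [Nonempty n] {A : Matrix n n ℝ} (hA : A.IsHermitian) :
    (spectrum ℝ A).Nonempty :=
  hA.spectrum_real_eq_range_eigenvalues ▸ Set.range_nonempty _

lemma eigMin_mem [Nonempty n] {A : Matrix n n ℝ} (hA : A.IsHermitian) :
    eigMin A ∈ spectrum ℝ A :=
  (spectrum_nonempty hA).csInf_mem (hA.spectrum_real_eq_range_eigenvalues ▸ Set.finite_range _)

lemma eigMax_mem [Nonempty n] {A : Matrix n n ℝ} (hA : A.IsHermitian) :
    eigMax A ∈ spectrum ℝ A :=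
  (spectrum_nonempty hA).csSup_mem (hA.spectrum_real_eq_range_eigenvalues ▸ Set.finite_range _)

omit [Fintype n] in
lemma isHermitian_smul_add {A : Matrix n n ℝ} (hA : A.IsHermitian) (a b : ℝ) :
    (a • A + b • (1 : Matrix n n ℝ)).IsHermitian := by
  have h : A.transpose = A := by
    simpa [Matrix.IsHermitian, Matrix.conjTranspose_eq_transpose_of_trivial] using hA
  rw [Matrix.IsHermitian, Matrix.conjTranspose_eq_transpose_of_trivial]
  simp [h]

lemma spectrum_smul_add [Nonempty n] {A : Matrix n n ℝ} (hA : A.IsHermitian) (a b : ℝ) :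
    spectrum ℝ (a • A + b • (1 : Matrix n n ℝ)) = (fun x => a * x + b) '' spectrum ℝ A := by
  have h1 : a • A + b • (1 : Matrix n n ℝ) = a • A + algebraMap ℝ _ b := by
    rw [Algebra.algebraMap_eq_smul_one]
  rw [h1, ← spectrum.add_singleton_eq, spectrum.smul_eq_smul _ _ (spectrum_nonempty hA)]
  ext x
  simp [Set.mem_smul_set, ← sub_eq_add_neg, eq_sub_iff_add_eq]

lemma eigMin_mul_le [Nonempty n] {A : Matrix n n ℝ} (hA : A.IsHermitian) (x : n → ℝ) :
    eigMin A * (x ⬝ᵥ x) ≤ x ⬝ᵥ A *ᵥ x := by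
  have h1 : ((1 : ℝ) • A + (-eigMin A) • (1 : Matrix n n ℝ)).PosSemidef := by
    rw [Matrix.posSemidef_iff_isHermitian_and_spectrum_nonneg]
    refine ⟨isHermitian_smul_add hA _ _, ?_⟩
    rw [spectrum_smul_add hA]
    rintro _ ⟨y, hy, rfl⟩
    have := eigMin_le_of_mem hA hy
    simp only [Set.mem_ofPred_eq]
    linarith
  have h2 := h1.dotProduct_mulVec_nonneg x
  simp only [one_smul, star_trivial, Matrix.add_mulVec, Matrix.smul_mulVec, Matrix.one_mulVec,
    dotProduct_add, dotProduct_smul, smul_eq_mul] at h2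
  linarith

lemma le_eigMax_mul [Nonempty n] {A : Matrix n n ℝ} (hA : A.IsHermitian) (x : n → ℝ) :
    x ⬝ᵥ A *ᵥ x ≤ eigMax A * (x ⬝ᵥ x) := by
  have h1 : ((-1 : ℝ) • A + (eigMax A) • (1 : Matrix n n ℝ)).PosSemidef := by
    rw [Matrix.posSemidef_iff_isHermitian_and_spectrum_nonneg]
    refine ⟨isHermitian_smul_add hA _ _, ?_⟩
    rw [spectrum_smul_add hA]
    rintro _ ⟨y, hy, rfl⟩
    have := le_eigMax_of_mem hA hy
    simp only [Set.mem_ofPred_eq]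
    linarith
  have h2 := h1.dotProduct_mulVec_nonneg x
  simp only [star_trivial, Matrix.add_mulVec, Matrix.smul_mulVec, Matrix.one_mulVec,
    dotProduct_add, dotProduct_smul, smul_eq_mul] at h2
  linarith

lemma eigMin_smul_add [Nonempty n] {A : Matrix n n ℝ} (hA : A.IsHermitian) {a : ℝ} (ha : 0 ≤ a)
    (b : ℝ) : eigMin (a • A + b • (1 : Matrix n n ℝ)) = a * eigMin A + b := by
  have hB := isHermitian_smul_add hA a b
  apply le_antisymm
  · exact eigMin_le_of_mem hB (spectrum_smul_add hA a b ▸ ⟨_, eigMin_mem hA, rfl⟩)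
  · obtain ⟨y, hy, h⟩ := (spectrum_smul_add hA a b).subset (eigMin_mem hB)
    rw [← h]
    have := eigMin_le_of_mem hA hy
    dsimp only
    gcongr

lemma eigMax_smul_add [Nonempty n] {A : Matrix n n ℝ} (hA : A.IsHermitian) {a : ℝ} (ha : 0 ≤ a)
    (b : ℝ) : eigMax (a • A + b • (1 : Matrix n n ℝ)) = a * eigMax A + b := by
  have hB := isHermitian_smul_add hA a b
  apply le_antisymm
  · obtain ⟨y, hy, h⟩ := (spectrum_smul_add hA a b).subset (eigMax_mem hB)
    rw [← h]
    have := le_eigMax_of_mem hA hy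
    dsimp only
    gcongr
  · exact le_eigMax_of_mem hB (spectrum_smul_add hA a b ▸ ⟨_, eigMax_mem hA, rfl⟩)

lemma eigMin_le_eigMax [Nonempty n] {A : Matrix n n ℝ} (hA : A.IsHermitian) :
    eigMin A ≤ eigMax A := le_eigMax_of_mem hA (eigMin_mem hA)

lemma eigMin_nonneg [Nonempty n] {A : Matrix n n ℝ} (hA : A.PosSemidef) : 0 ≤ eigMin A :=
  (Matrix.posSemidef_iff_isHermitian_and_spectrum_nonneg.1 hA).2 (eigMin_mem hA.1)

variable {N d : ℕ} [Nonempty (Fin N × Fin d)] {Γ : Matrix (Fin N) (Fin N) ℝ}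
  {S : Matrix (Fin d) (Fin d) ℝ}

/-- The noise level bounds the spectrum of the diffused covariance from below. -/
lemma sigma_sq_le_eigMin (hG : (Γ ⊗ₖ S).PosSemidef) (t : ℝ) :
    sigma t ^ 2 ≤ eigMin (diffusedCov Γ S t) := by
  rw [diffusedCov, eigMin_smul_add hG.1 (by positivity)]
  have := eigMin_nonneg hG
  have := mul_nonneg (sq_nonneg (alpha t)) this
  linarith

/-- Noising improves the conditioning. -/
lemma condNumber_antitone (hG : (Γ ⊗ₖ S).PosSemidef) {t₀ t : ℝ} (h0 : 0 < t₀) (ht : t₀ ≤ t) :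
    condNumber (diffusedCov Γ S t) ≤ condNumber (diffusedCov Γ S t₀) := by
  have hp := (pow_pos (sigma_pos (h0.trans_le ht)) 2).trans_le (sigma_sq_le_eigMin hG t)
  have hp0 := (pow_pos (sigma_pos h0) 2).trans_le (sigma_sq_le_eigMin hG t₀)
  rw [condNumber, condNumber, div_le_div_iff₀ hp hp0]
  simp only [diffusedCov, eigMin_smul_add hG.1 (sq_nonneg _), eigMax_smul_add hG.1 (sq_nonneg _)]
  rw [alpha_sq, alpha_sq, sigma_sq h0.le, sigma_sq (h0.le.trans ht)]
  have h1 : Real.exp (-t) ≤ Real.exp (-t₀) := Real.exp_le_exp.2 (by linarith)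
  nlinarith [mul_nonneg (sub_nonneg.2 h1) (sub_nonneg.2 (eigMin_le_eigMax hG.1))]

lemma one_le_condNumber (hG : (Γ ⊗ₖ S).PosSemidef) {t : ℝ} (ht : 0 < t) :
    1 ≤ condNumber (diffusedCov Γ S t) := by
  have hp := (pow_pos (sigma_pos ht) 2).trans_le (sigma_sq_le_eigMin hG t)
  rw [condNumber, one_le_div hp]
  exact eigMin_le_eigMax (isHermitian_smul_add hG.1 _ _)

end Spectral

/-! ### Gradient descent with a perturbed Hessian -/

section Descent

variable {E : Type*} [NormedAddCommGroup E] [InnerProductSpace ℝ E]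

/-- One gradient step `x ↦ x - η B x` contracts if `η` is at most the inverse of the upper bound on
the positive operator `B`. -/
lemma norm_sub_smul_le {B : E →ₗ[ℝ] E} (hB : B.IsSymmetric) {a b η : ℝ} (ha : 0 ≤ a)
    (hlow : ∀ x, a * ‖x‖ ^ 2 ≤ inner ℝ x (B x)) (hup : ∀ x, inner ℝ x (B x) ≤ b * ‖x‖ ^ 2)
    (hη : 0 ≤ η) (hηb : η * b ≤ 1) (x : E) :
    ‖x - η • B x‖ ≤ Real.exp (-(η * a / 2)) * ‖x‖ := by
  have h1 : η * ‖B x‖ ^ 2 ≤ inner ℝ x (B x) := by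
    have h2 := (mul_nonneg ha (sq_nonneg _)).trans (hlow (x - η • B x))
    have h3 := hup (B x)
    have h4 : inner ℝ x (B (B x)) = ‖B x‖ ^ 2 := by
      rw [← hB x (B x), real_inner_self_eq_norm_sq]
    rw [map_sub, map_smul, inner_sub_left, inner_sub_right, inner_sub_right,
      real_inner_smul_left, real_inner_smul_left, real_inner_smul_right, real_inner_smul_right,
      real_inner_self_eq_norm_sq, h4] at h2
    have h5 : η * (η * inner ℝ (B x) (B (B x))) ≤ η * ‖B x‖ ^ 2 := by
      refine mul_le_mul_of_nonneg_left ?_ hη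
      calc η * inner ℝ (B x) (B (B x)) ≤ η * (b * ‖B x‖ ^ 2) := by gcongr
        _ = (η * b) * ‖B x‖ ^ 2 := by ring
        _ ≤ 1 * ‖B x‖ ^ 2 := by gcongr
        _ = _ := one_mul _
    linarith
  have h6 : ‖x - η • B x‖ ^ 2 ≤ (1 - η * a) * ‖x‖ ^ 2 := by
    rw [norm_sub_sq_real, norm_smul, real_inner_smul_right, mul_pow, Real.norm_eq_abs, sq_abs]
    have h7 := mul_le_mul_of_nonneg_left h1 hη
    have h8 := mul_le_mul_of_nonneg_left (hlow x) hη
    nlinarith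
  have h9 : ‖x - η • B x‖ ^ 2 ≤ (Real.exp (-(η * a / 2)) * ‖x‖) ^ 2 := by
    refine h6.trans ?_
    rw [mul_pow, ← Real.exp_nat_mul]
    gcongr
    have := Real.add_one_le_exp (-(η * a))
    calc 1 - η * a ≤ Real.exp (-(η * a)) := by linarith
      _ = _ := by congr 1; push_cast; ring
  exact (pow_le_pow_iff_left₀ (norm_nonneg _) (by positivity) two_ne_zero).1 h9

/-- The gradient descent iterates for the objective `½ ⟪s, B s⟫ + ⟪s, z⟫`, started at `0`. -/
def descent (B : E →ₗ[ℝ] E) (η : ℝ) (z : E) : ℕ → E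
  | 0 => 0
  | k + 1 => descent B η z k - η • (B (descent B η z k) + z)

/-- Gradient descent with a perturbed Hessian `B` still approximates the minimiser `-y`, `A y = z`,
of the unperturbed objective, if `B - A` is small relative to the quadratic form of `A`. The error
is a multiple of `⟪y, A y⟫`. -/
lemma norm_descent_add_le [FiniteDimensional ℝ E] {A B : E →ₗ[ℝ] E} (hB : B.IsSymmetric)
    {τ σ a b η : ℝ} (hτ0 : 0 ≤ τ) (hτ : τ ≤ 1 / 2) (hσ : 0 < σ)
    (hA : ∀ x, σ ^ 2 * ‖x‖ ^ 2 ≤ inner ℝ x (A x))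
    (hrel : ∀ u v, inner ℝ u (B v - A v) ^ 2 ≤ τ ^ 2 * (inner ℝ u (A u) * inner ℝ v (A v)))
    (ha : 0 < a) (hlow : ∀ x, a * ‖x‖ ^ 2 ≤ inner ℝ x (B x))
    (hup : ∀ x, inner ℝ x (B x) ≤ b * ‖x‖ ^ 2) (hη : 0 ≤ η) (hηb : η * b ≤ 1) (y : E) (k : ℕ) :
    σ * ‖descent B η (A y) k + y‖ ≤
      (2 * Real.exp (-(η * a / 2)) ^ k + 2 * τ) * Real.sqrt (inner ℝ y (A y)) := by
  have hA0 : ∀ x, 0 ≤ inner ℝ x (A x) := fun x => (by positivity : (0:ℝ) ≤ _).trans (hA x)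
  have hinj : Function.Injective B := by
    rw [injective_iff_map_eq_zero]
    intro x hx
    have := hlow x
    rw [hx, inner_zero_right] at this
    have h2 : ‖x‖ ^ 2 ≤ 0 := by nlinarith
    simpa using le_antisymm h2 (sq_nonneg _)
  obtain ⟨v, hv⟩ := LinearMap.injective_iff_surjective.1 hinj (B y - A y)
  -- `B (y - v) = A y`, so that the iterates converge to `-(y - v)`.
  set V := inner ℝ v (A v) with hV
  set Y := inner ℝ y (A y) with hY
  have hVY : V ≤ (2 * τ) ^ 2 * Y := by
    have h1 := hrel v v
    have h2 := hrel v y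
    rw [← hv] at h2
    have h3 : (1 - τ) * V ≤ inner ℝ v (B v) := by
      have h4 : |inner ℝ v (B v - A v)| ≤ τ * V := by
        refine abs_le_of_sq_le_sq ?_ (mul_nonneg hτ0 (hA0 v))
        rw [mul_pow, sq V]
        exact h1
      rw [inner_sub_right] at h4
      have := (abs_le.1 h4).1
      linarith
    have h5 : V / 2 ≤ inner ℝ v (B v) := by nlinarith [hA0 v]
    have h6 : (V / 2) ^ 2 ≤ τ ^ 2 * (V * Y) :=
      (pow_le_pow_left₀ (by linarith [hA0 v]) h5 2).trans h2
    rcases (hA0 v).eq_or_lt with h7 | h7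
    · rw [hV, ← h7]; have := hA0 y; positivity
    · have h8 : V * V ≤ V * ((2 * τ) ^ 2 * Y) := by nlinarith
      exact le_of_mul_le_mul_left h8 h7
  have hy1 : σ * ‖y‖ ≤ Real.sqrt Y := by
    refine Real.le_sqrt_of_sq_le ?_
    rw [mul_pow]; exact hA y
  have hv1 : σ * ‖v‖ ≤ 2 * τ * Real.sqrt Y := by
    rw [← Real.sqrt_sq (by positivity : (0:ℝ) ≤ 2 * τ), ← Real.sqrt_mul (sq_nonneg _)]
    refine Real.le_sqrt_of_sq_le ?_
    rw [mul_pow]; exact (hA v).trans hVY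
  have hT : ∀ k, ‖descent B η (A y) k + y - v‖ ≤ Real.exp (-(η * a / 2)) ^ k * ‖y - v‖ := by
    intro k
    induction k with
    | zero => simp [descent]
    | succ k ih =>
      have h1 : descent B η (A y) (k + 1) + y - v = (descent B η (A y) k + y - v) -
          η • B (descent B η (A y) k + y - v) := by
        rw [descent, map_sub, map_add, hv]
        module
      rw [h1, pow_succ']
      calc _ ≤ _ := norm_sub_smul_le hB ha.le hlow hup hη hηb _
        _ ≤ _ := by rw [mul_assoc]; gcongr
  have h2 : ‖descent B η (A y) k + y‖ ≤
      Real.exp (-(η * a / 2)) ^ k * ‖y - v‖ + ‖v‖ := by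
    calc _ = ‖(descent B η (A y) k + y - v) + v‖ := by rw [sub_add_cancel]
      _ ≤ _ := (norm_add_le _ _).trans (by gcongr; exact hT k)
  have h3 : σ * ‖y - v‖ ≤ 2 * Real.sqrt Y := by
    calc σ * ‖y - v‖ ≤ σ * (‖y‖ + ‖v‖) := by gcongr; exact norm_sub_le _ _
      _ ≤ Real.sqrt Y + 2 * τ * Real.sqrt Y := by linarith
      _ ≤ _ := by nlinarith [Real.sqrt_nonneg Y]
  calc _ ≤ σ * (Real.exp (-(η * a / 2)) ^ k * ‖y - v‖ + ‖v‖) := by gcongr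
    _ = Real.exp (-(η * a / 2)) ^ k * (σ * ‖y - v‖) + σ * ‖v‖ := by ring
    _ ≤ Real.exp (-(η * a / 2)) ^ k * (2 * Real.sqrt Y) + 2 * τ * Real.sqrt Y := by gcongr
    _ = _ := by ring

end Descent

/-! ### Perturbation of the temporal covariance -/

section Kronecker

variable {N d : ℕ}

/-- The quadratic form of `M ⊗ BᵀB` splits over the rows of `B`. -/
lemma dotProduct_kronecker_mulVec (M : Matrix (Fin N) (Fin N) ℝ) (B : Matrix (Fin d) (Fin d) ℝ)
    (u v : Fin N × Fin d → ℝ) :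
    u ⬝ᵥ (M ⊗ₖ (Bᵀ * B)) *ᵥ v = ∑ a, (fun i => (B *ᵥ fun b => u (i, b)) a) ⬝ᵥ
      M *ᵥ (fun j => (B *ᵥ fun b => v (j, b)) a) := by
  simp only [dotProduct, Matrix.mulVec, Fintype.sum_prod_type, Matrix.kroneckerMap_apply,
    Matrix.mul_apply, Matrix.transpose_apply, Finset.mul_sum, Finset.sum_mul]
  have h : ∀ (f : Fin N → Fin d → Fin N → Fin d → Fin d → ℝ),
      ∑ i, ∑ b, ∑ j, ∑ c, ∑ a, f i b j c a = ∑ a, ∑ i, ∑ j, ∑ c, ∑ b, f i b j c a := by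
    intro f
    calc _ = ∑ i, ∑ b, ∑ j, ∑ a, ∑ c, f i b j c a := by
          refine Finset.sum_congr rfl fun i _ => Finset.sum_congr rfl fun b _ =>
            Finset.sum_congr rfl fun j _ => Finset.sum_comm
      _ = ∑ i, ∑ b, ∑ a, ∑ j, ∑ c, f i b j c a := by
          refine Finset.sum_congr rfl fun i _ => Finset.sum_congr rfl fun b _ => Finset.sum_comm
      _ = ∑ i, ∑ a, ∑ b, ∑ j, ∑ c, f i b j c a :=
          Finset.sum_congr rfl fun i _ => Finset.sum_comm
      _ = ∑ a, ∑ i, ∑ b, ∑ j, ∑ c, f i b j c a := Finset.sum_comm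
      _ = ∑ a, ∑ i, ∑ j, ∑ b, ∑ c, f i b j c a := by
          refine Finset.sum_congr rfl fun i _ => Finset.sum_congr rfl fun b _ => Finset.sum_comm
      _ = _ := by
          refine Finset.sum_congr rfl fun i _ => Finset.sum_congr rfl fun b _ =>
            Finset.sum_congr rfl fun j _ => Finset.sum_comm
  rw [h]
  exact Finset.sum_congr rfl fun a _ => Finset.sum_congr rfl fun i _ =>
    Finset.sum_congr rfl fun j _ => Finset.sum_congr rfl fun c _ =>
    Finset.sum_congr rfl fun b _ => by ring

/-- An entrywise small perturbation of the temporal covariance `Γ` is small relative to the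
quadratic form of the diffused covariance, because `Γ` is bounded below: no bound on the spatial
covariance is needed. -/
lemma sq_dotProduct_perturbation_le {Γ Γ' : Matrix (Fin N) (Fin N) ℝ}
    {S : Matrix (Fin d) (Fin d) ℝ} (hS : S.PosSemidef) {ε δ : ℝ} (hε : 0 < ε)
    (hΓ : ∀ x, ε * (x ⬝ᵥ x) ≤ x ⬝ᵥ Γ *ᵥ x) (hΓ' : ∀ i j, |Γ' i j - Γ i j| ≤ δ) (t : ℝ)
    (u v : Fin N × Fin d → ℝ) :
    (u ⬝ᵥ (diffusedCov Γ' S t *ᵥ v - diffusedCov Γ S t *ᵥ v)) ^ 2 ≤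
      (N * δ / ε) ^ 2 * ((u ⬝ᵥ diffusedCov Γ S t *ᵥ u) * (v ⬝ᵥ diffusedCov Γ S t *ᵥ v)) := by
  obtain ⟨B, rfl⟩ := CStarAlgebra.nonneg_iff_eq_star_mul_self.mp hS.nonneg
  rw [Matrix.star_eq_conjTranspose, Matrix.conjTranspose_eq_transpose_of_trivial]
  have hα := alpha_pos t
  let w : (Fin N × Fin d → ℝ) → Fin d → Fin N → ℝ := fun u a i => (B *ᵥ fun b => u (i, b)) a
  have hlow : ∀ u : Fin N × Fin d → ℝ, alpha t ^ 2 * (ε * ∑ a, ∑ i, w u a i ^ 2) ≤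
      u ⬝ᵥ diffusedCov Γ (Bᵀ * B) t *ᵥ u := by
    intro u
    rw [diffusedCov, Matrix.add_mulVec, Matrix.smul_mulVec, Matrix.smul_mulVec, Matrix.one_mulVec,
      dotProduct_add, dotProduct_smul, dotProduct_smul, dotProduct_kronecker_mulVec, smul_eq_mul,
      smul_eq_mul, Finset.mul_sum]
    have h1 : 0 ≤ sigma t ^ 2 * (u ⬝ᵥ u) := by
      have : 0 ≤ u ⬝ᵥ u := Finset.sum_nonneg fun i _ => mul_self_nonneg _
      positivity
    refine le_add_of_le_of_nonneg ?_ h1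
    refine mul_le_mul_of_nonneg_left (Finset.sum_le_sum fun a _ => ?_) (by positivity)
    refine le_trans (le_of_eq ?_) (hΓ (w u a))
    simp only [dotProduct, sq]
  have hdiff : u ⬝ᵥ (diffusedCov Γ' (Bᵀ * B) t *ᵥ v - diffusedCov Γ (Bᵀ * B) t *ᵥ v) =
      alpha t ^ 2 * ∑ a, w u a ⬝ᵥ (Γ' - Γ) *ᵥ w v a := by
    have h1 : diffusedCov Γ' (Bᵀ * B) t *ᵥ v - diffusedCov Γ (Bᵀ * B) t *ᵥ v =
        alpha t ^ 2 • (((Γ' - Γ) ⊗ₖ (Bᵀ * B)) *ᵥ v) := by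
      rw [← Matrix.sub_mulVec, diffusedCov, diffusedCov, add_sub_add_right_eq_sub, ← smul_sub,
        Matrix.smul_mulVec]
      congr 2
      ext p q
      simp [sub_mul]
    rw [h1, dotProduct_smul, dotProduct_kronecker_mulVec, smul_eq_mul]
  have habs : |∑ a, w u a ⬝ᵥ (Γ' - Γ) *ᵥ w v a| ≤ ∑ a, δ * ((∑ i, |w u a i|) * ∑ j, |w v a j|) := by
    refine (Finset.abs_sum_le_sum_abs _ _).trans (Finset.sum_le_sum fun a _ => ?_)
    simp only [dotProduct, Matrix.mulVec, Finset.mul_sum, Finset.sum_mul]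
    rw [Finset.sum_comm]
    refine (Finset.abs_sum_le_sum_abs _ _).trans (Finset.sum_le_sum fun j _ => ?_)
    refine (Finset.abs_sum_le_sum_abs _ _).trans (Finset.sum_le_sum fun i _ => ?_)
    rw [abs_mul, abs_mul, Matrix.sub_apply]
    calc |w u a i| * (|Γ' i j - Γ i j| * |w v a j|) ≤ |w u a i| * (δ * |w v a j|) := by
          gcongr; exact hΓ' i j
      _ = _ := by ring
  have hsq : ∀ u : Fin N × Fin d → ℝ, ∑ a, (∑ i, |w u a i|) ^ 2 ≤ N * ∑ a, ∑ i, w u a i ^ 2 := by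
    intro u
    rw [Finset.mul_sum]
    refine Finset.sum_le_sum fun a _ => ?_
    have := sq_sum_le_card_mul_sum_sq (s := Finset.univ) (f := fun i => |w u a i|)
    simpa using this
  have hw0 : ∀ u : Fin N × Fin d → ℝ, 0 ≤ ∑ a, ∑ i, w u a i ^ 2 := fun u => by positivity
  have hcs := Finset.sum_mul_sq_le_sq_mul_sq Finset.univ (fun a => ∑ i, |w u a i|)
    (fun a => ∑ j, |w v a j|)
  rw [hdiff]
  calc (alpha t ^ 2 * ∑ a, w u a ⬝ᵥ (Γ' - Γ) *ᵥ w v a) ^ 2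
      ≤ (alpha t ^ 2 * ∑ a, δ * ((∑ i, |w u a i|) * ∑ j, |w v a j|)) ^ 2 := by
        rw [sq_le_sq, abs_mul, abs_mul]
        exact mul_le_mul_of_nonneg_left (habs.trans (le_abs_self _)) (abs_nonneg _)
    _ = (alpha t ^ 2 * δ) ^ 2 * (∑ a, (∑ i, |w u a i|) * ∑ j, |w v a j|) ^ 2 := by
        rw [← Finset.mul_sum]; ring
    _ ≤ (alpha t ^ 2 * δ) ^ 2 * ((∑ a, (∑ i, |w u a i|) ^ 2) * ∑ a, (∑ j, |w v a j|) ^ 2) := by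
        gcongr
    _ ≤ (alpha t ^ 2 * δ) ^ 2 * ((N * ∑ a, ∑ i, w u a i ^ 2) * (N * ∑ a, ∑ i, w v a i ^ 2)) := by
        gcongr
        · exact hsq u
        · exact hsq v
    _ = (N * δ / ε) ^ 2 * ((alpha t ^ 2 * (ε * ∑ a, ∑ i, w u a i ^ 2)) *
          (alpha t ^ 2 * (ε * ∑ a, ∑ i, w v a i ^ 2))) := by
        field_simp
    _ ≤ _ := by
        have := hw0 u
        have := hw0 v
        gcongr
        · exact (by positivity : (0:ℝ) ≤ _).trans (hlow u)
        · exact hlow u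
        · exact hlow v

end Kronecker

/-! ### Interpolation of the covariance by rectifiers -/

section Interpolation

/-- Slopes of the covariance, seen as a function of the inner product of two time embeddings,
are bounded: the embeddings of different times are at least `c` apart. -/
lemma slope_le {c ν ℓ x y : ℝ} (hc : 0 < c) (hν1 : 1 ≤ ν) (hν2 : ν ≤ 2) (hℓ : 0 < ℓ)
    (hx : x = 0 ∨ c ≤ x) (hy : c ≤ y) (hxy : x < y) :
    |(Real.exp (-(x ^ ν / ℓ)) - Real.exp (-(y ^ ν / ℓ))) / (y ^ 2 / 2 - x ^ 2 / 2)| ≤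
      2 / c ^ 2 := by
  have hx0 : 0 ≤ x := by rcases hx with h | h <;> linarith
  have hy0 : 0 < y := hc.trans_le hy
  have hmono : x ^ ν ≤ y ^ ν := Real.rpow_le_rpow hx0 hxy.le (by linarith)
  have hle : Real.exp (-(y ^ ν / ℓ)) ≤ Real.exp (-(x ^ ν / ℓ)) :=
    Real.exp_le_exp.2 (neg_le_neg (by gcongr))
  have hsq : 0 < y ^ 2 / 2 - x ^ 2 / 2 := by nlinarith
  rw [abs_of_nonneg (div_nonneg (by linarith) hsq.le), div_le_div_iff₀ hsq (by positivity)]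
  rcases hx with rfl | hx
  · rw [Real.zero_rpow (by linarith)]
    have h1 := Real.exp_pos (-(y ^ ν / ℓ))
    have h2 : Real.exp (-(0 / ℓ)) = 1 := by simp
    rw [h2]
    nlinarith
  · have hxp : 0 < x := hc.trans_le hx
    -- `y ^ ν - x ^ ν ≤ x ^ (ν - 2) (y ^ 2 - x ^ 2)` because `ν ≤ 2`.
    have h1 : x ^ 2 * (y ^ ν - x ^ ν) ≤ x ^ ν * (y ^ 2 - x ^ 2) := by
      have h2 : y ^ ν * x ^ 2 ≤ x ^ ν * y ^ 2 := by
        have h3 : y ^ ν = y ^ 2 * y ^ (ν - 2) := by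
          rw [← Real.rpow_natCast, ← Real.rpow_add hy0]; congr 1; push_cast; ring
        have h4 : x ^ ν = x ^ 2 * x ^ (ν - 2) := by
          rw [← Real.rpow_natCast, ← Real.rpow_add hxp]; congr 1; push_cast; ring
        have h5 : y ^ (ν - 2) ≤ x ^ (ν - 2) :=
          Real.rpow_le_rpow_of_nonpos hxp hxy.le (by linarith)
        rw [h3, h4]
        nlinarith [mul_le_mul_of_nonneg_left h5 (by positivity : 0 ≤ x ^ 2 * y ^ 2)]
      linarith
    set p := x ^ ν / ℓ with hp
    set q := y ^ ν / ℓ with hq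
    have h6 : Real.exp (-p) - Real.exp (-q) ≤ Real.exp (-p) * (q - p) := by
      have h7 : Real.exp (-q) = Real.exp (-p) * Real.exp (-(q - p)) := by
        rw [← Real.exp_add]; ring_nf
      have h8 := Real.add_one_le_exp (-(q - p))
      rw [h7]
      nlinarith [Real.exp_pos (-p)]
    have h9 : p * Real.exp (-p) ≤ 1 := by
      rw [Real.exp_neg, ← div_eq_mul_inv, div_le_one (Real.exp_pos _)]
      linarith [Real.add_one_le_exp p]
    have h10 : x ^ 2 * (q - p) ≤ p * (y ^ 2 - x ^ 2) := by
      rw [hp, hq, ← sub_div, mul_div_assoc', div_mul_eq_mul_div]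
      gcongr
    have h11 : x ^ 2 * (Real.exp (-p) - Real.exp (-q)) ≤ y ^ 2 - x ^ 2 := by
      calc x ^ 2 * (Real.exp (-p) - Real.exp (-q)) ≤ x ^ 2 * (Real.exp (-p) * (q - p)) := by gcongr
        _ = Real.exp (-p) * (x ^ 2 * (q - p)) := by ring
        _ ≤ Real.exp (-p) * (p * (y ^ 2 - x ^ 2)) := by gcongr
        _ = (p * Real.exp (-p)) * (y ^ 2 - x ^ 2) := by ring
        _ ≤ 1 * (y ^ 2 - x ^ 2) := by gcongr; nlinarith
        _ = _ := one_mul _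
    have h12 : c ^ 2 ≤ x ^ 2 := by gcongr
    nlinarith [mul_le_mul_of_nonneg_right h12 (sub_nonneg.2 hle)]

/-- Piecewise linear interpolation by differences of rectifiers: at the knots `v 0 > v 1 > …` the
sum takes the values `g 0, g 1, …` up to index `J`, and `g J` from there on. -/
lemma interpolation {N : ℕ} {v g : ℕ → ℝ} (hv : StrictAntiOn v (Set.Iio N)) {J m : ℕ} (hJ : J < N)
    (hm : m < N) :
    g J + ∑ k ∈ Finset.range J, (g k - g (k + 1)) / (v k - v (k + 1)) *
      (relu (v m - v (k + 1)) - relu (v m - v k)) = g (min m J) := by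
  have hterm : ∀ k ∈ Finset.range J, (g k - g (k + 1)) / (v k - v (k + 1)) *
      (relu (v m - v (k + 1)) - relu (v m - v k)) = if m ≤ k then g k - g (k + 1) else 0 := by
    intro k hk
    rw [Finset.mem_range] at hk
    have h1 : v (k + 1) < v k := hv (Set.mem_Iio.2 (by omega)) (Set.mem_Iio.2 (by omega)) (by omega)
    split_ifs with hmk
    · have h2 : v k ≤ v m := hv.antitoneOn (Set.mem_Iio.2 hm) (Set.mem_Iio.2 (by omega)) hmk
      rw [relu, relu, max_eq_left (by linarith), max_eq_left (by linarith)]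
      have : v k - v (k + 1) ≠ 0 := by linarith
      field_simp
      ring
    · have h2 : v m ≤ v (k + 1) :=
        hv.antitoneOn (Set.mem_Iio.2 (by omega)) (Set.mem_Iio.2 hm) (by omega)
      rw [relu, relu, max_eq_right (by linarith), max_eq_right (by linarith)]
      ring
  rw [Finset.sum_congr rfl hterm]
  rcases le_total m J with h | h
  · rw [min_eq_left h, ← Finset.sum_filter]
    have h2 : (Finset.range J).filter (fun k => m ≤ k) = Finset.Ico m J := by
      ext k; simp [and_comm]
    rw [h2]
    have h3 := Finset.sum_Ico_sub (f := g) h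
    have h4 : ∑ k ∈ Finset.Ico m J, (g k - g (k + 1)) =
        -∑ k ∈ Finset.Ico m J, (g (k + 1) - g k) := by
      rw [← Finset.sum_neg_distrib]
      exact Finset.sum_congr rfl fun k _ => by ring
    rw [h4, h3]
    ring
  · rw [min_eq_right h, Finset.sum_eq_zero, add_zero]
    intro k hk
    rw [Finset.mem_range] at hk
    rw [if_neg (by omega)]

end Interpolation

/-! ### Projection onto the time embeddings -/

section Projection

/-- The orthogonal projection onto the span of `N` vectors has Frobenius norm at most `√N`. In query
and key matrices it replaces the identity, whose norm would grow with the embedding dimension. -/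
lemma exists_projection {N de : ℕ} (e : Fin N → EuclideanSpace ℝ (Fin de)) :
    ∃ Q : Matrix (Fin de) (Fin de) ℝ, (∀ i, Q *ᵥ (e i) = e i) ∧ ∑ a, ∑ b, Q a b ^ 2 ≤ N := by
  set W : Submodule ℝ (EuclideanSpace ℝ (Fin de)) := Submodule.span ℝ (Set.range e) with hW
  set w := stdOrthonormalBasis ℝ W
  refine ⟨Matrix.of fun a b => ∑ k, (w k : EuclideanSpace ℝ (Fin de)) a *
    (w k : EuclideanSpace ℝ (Fin de)) b, ?_, ?_⟩
  · intro i
    have hi : e i ∈ W := Submodule.subset_span ⟨i, rfl⟩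
    have h1 := congrArg Subtype.val (w.sum_repr' ⟨e i, hi⟩)
    ext a
    have h2 := congrArg (fun z : EuclideanSpace ℝ (Fin de) => z a) h1
    simp only [Submodule.coe_sum, Submodule.coe_smul, Submodule.coe_inner, WithLp.ofLp_sum,
      Finset.sum_apply, WithLp.ofLp_smul, Pi.smul_apply, smul_eq_mul, PiLp.inner_apply] at h2
    rw [← h2]
    simp only [Matrix.mulVec, dotProduct, Matrix.of_apply, Finset.sum_mul]
    rw [Finset.sum_comm]
    refine Finset.sum_congr rfl fun k _ => Finset.sum_congr rfl fun b _ => ?_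
    simp
    ring
  · have horth : ∀ k l, ∑ a, (w k : EuclideanSpace ℝ (Fin de)) a *
        (w l : EuclideanSpace ℝ (Fin de)) a = if k = l then 1 else 0 := by
      intro k l
      have h := orthonormal_iff_ite.1 w.orthonormal k l
      rw [Submodule.coe_inner, PiLp.inner_apply] at h
      rw [← h]
      exact Finset.sum_congr rfl fun a _ => by simp [mul_comm]
    have h1 : ∑ a, ∑ b, (∑ k, (w k : EuclideanSpace ℝ (Fin de)) a *
        (w k : EuclideanSpace ℝ (Fin de)) b) ^ 2 = Module.finrank ℝ W := by
      calc _ = ∑ a, ∑ b, ∑ k, ∑ l, ((w k : EuclideanSpace ℝ (Fin de)) a *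
            (w l : EuclideanSpace ℝ (Fin de)) a) * ((w k : EuclideanSpace ℝ (Fin de)) b *
            (w l : EuclideanSpace ℝ (Fin de)) b) := by
            refine Finset.sum_congr rfl fun a _ => Finset.sum_congr rfl fun b _ => ?_
            rw [sq, Finset.sum_mul_sum]
            exact Finset.sum_congr rfl fun k _ => Finset.sum_congr rfl fun l _ => by ring
        _ = ∑ k, ∑ l, (∑ a, (w k : EuclideanSpace ℝ (Fin de)) a *
            (w l : EuclideanSpace ℝ (Fin de)) a) * ∑ b, (w k : EuclideanSpace ℝ (Fin de)) b *
            (w l : EuclideanSpace ℝ (Fin de)) b := by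
            simp_rw [Finset.sum_mul_sum]
            rw [Finset.sum_comm' (t' := Finset.univ) (s' := fun _ => Finset.univ) (by simp)]
            rw [Finset.sum_comm]
            simp_rw [Finset.sum_comm (s := (Finset.univ : Finset (Fin de)))
              (t := (Finset.univ : Finset (Fin (Module.finrank ℝ W))))]
        _ = ∑ k : Fin (Module.finrank ℝ W), (1 : ℝ) := by
            simp [horth]
        _ = _ := by simp
    simp only [Matrix.of_apply]
    rw [h1]
    have h2 := finrank_range_le_card (R := ℝ) e
    rw [Fintype.card_fin] at h2
    exact_mod_cast h2

end Projection

variable {N d de : ℕ}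

/-! ### Attention heads as gates -/

section Gates

/-- Tokens whose five buffer blocks hold the vectors `f 0, …, f 4` of `ℝᵈᴺ`. -/
def bufferTokens (x : EuclideanSpace ℝ (Fin N × Fin d)) (e : Fin N → EuclideanSpace ℝ (Fin de))
    (φ : Fin 4 → ℝ) (f : Fin 5 → Fin N × Fin d → ℝ) : Matrix (Coord d de) (Fin N) ℝ :=
  tokens x e φ fun i p => f p.1 (i, p.2)

/-- The matrix with the vectors `f 0, …, f 4` in its buffer blocks and zeros elsewhere. -/
def bufferMatrix (de : ℕ) : (Fin 5 → Fin N × Fin d → ℝ) →+ Matrix (Coord d de) (Fin N) ℝ where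
  toFun f := Matrix.of fun k i => Sum.elim (fun _ => 0) (Sum.elim (fun _ => 0)
    (Sum.elim (fun _ => 0) (Sum.elim (fun p => f p.1 (i, p.2))
      (Sum.elim (fun _ => 0) fun _ => 0)))) k
  map_zero' := by ext (k | k | k | k | k | k) i <;> rfl
  map_add' f g := by ext (k | k | k | k | k | k) i <;> simp

lemma bufferTokens_add (x : EuclideanSpace ℝ (Fin N × Fin d))
    (e : Fin N → EuclideanSpace ℝ (Fin de)) (φ : Fin 4 → ℝ) (f g : Fin 5 → Fin N × Fin d → ℝ) :
    bufferTokens x e φ f + bufferMatrix de g = bufferTokens x e φ (f + g) := by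
  ext (k | k | k | k | k | k) i <;> simp [bufferTokens, bufferMatrix, tokens]

/-- Parameters of an attention head which adds to the buffer block `dst` of token `j` the sum over
the tokens `i` of `relu (lam ⟪eᵢ, eⱼ⟫ + b + g ⬝ φ) • A *ᵥ sᵢ`, with `sᵢ` the source block of token
`i`: the patch itself for `src = none`, a buffer block otherwise. -/
structure Gate (d : ℕ) where
  src : Option (Fin 5)
  dst : Fin 5
  A : Matrix (Fin d) (Fin d) ℝ
  lam : ℝ
  b : ℝ
  g : Fin 4 → ℝ

/-- The value matrix of a gate. -/
def Gate.value (a : Gate d) (de : ℕ) : Matrix (Coord d de) (Coord d de) ℝ :=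
  Matrix.of fun k l => match k, l with
    | .inr (.inr (.inr (.inl p))), .inl q =>
      if p.1 = a.dst ∧ a.src = none then a.A p.2 q else 0
    | .inr (.inr (.inr (.inl p))), .inr (.inr (.inr (.inl q))) =>
      if p.1 = a.dst ∧ a.src = some q.1 then a.A p.2 q.2 else 0
    | _, _ => 0

/-- The query matrix of a gate: it keeps the time embedding, through a matrix `Q` that fixes all
time embeddings, and the constant coordinate. -/
def gateQuery (d : ℕ) (Q : Matrix (Fin de) (Fin de) ℝ) : Matrix (Coord d de) (Coord d de) ℝ :=
  Matrix.of fun k l => match k, l with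
    | .inr (.inl p), .inr (.inl q) => Q p q
    | .inr (.inr (.inr (.inr (.inl _)))), .inr (.inr (.inr (.inr (.inl _)))) => 1
    | _, _ => 0

/-- The key matrix of a gate: it scales the time embedding by `lam` and puts `b + g ⬝ φ` into the
constant coordinate. -/
def Gate.key (a : Gate d) (Q : Matrix (Fin de) (Fin de) ℝ) :
    Matrix (Coord d de) (Coord d de) ℝ :=
  Matrix.of fun k l => match k, l with
    | .inr (.inl p), .inr (.inl q) => a.lam * Q p q
    | .inr (.inr (.inr (.inr (.inl _)))), .inr (.inr (.inr (.inr (.inl _)))) => a.b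
    | .inr (.inr (.inr (.inr (.inl _)))), .inr (.inr (.inl q)) => a.g q
    | _, _ => 0

/-- The attention head with the parameters of a gate. -/
def Gate.head (a : Gate d) (Q : Matrix (Fin de) (Fin de) ℝ) : Head (Coord d de) :=
  ⟨a.value de, gateQuery d Q, a.key Q⟩

/-- The source vector of a gate. -/
def Gate.source (a : Gate d) (x : EuclideanSpace ℝ (Fin N × Fin d))
    (f : Fin 5 → Fin N × Fin d → ℝ) : Fin N × Fin d → ℝ :=
  a.src.elim x f

/-- The attention weights of a gate, with the receiving token as the row index. -/
def Gate.weights (a : Gate d) (e : Fin N → EuclideanSpace ℝ (Fin de)) (φ : Fin 4 → ℝ) :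
    Matrix (Fin N) (Fin N) ℝ :=
  Matrix.of fun j i => relu (a.lam * inner ℝ (e i) (e j) + a.b + a.g ⬝ᵥ φ)

/-- What a gate adds to the buffers. -/
def Gate.update (a : Gate d) (x : EuclideanSpace ℝ (Fin N × Fin d))
    (e : Fin N → EuclideanSpace ℝ (Fin de)) (φ : Fin 4 → ℝ) (f : Fin 5 → Fin N × Fin d → ℝ) :
    Fin 5 → Fin N × Fin d → ℝ :=
  Pi.single a.dst ((a.weights e φ ⊗ₖ a.A) *ᵥ a.source x f)

lemma Gate.head_eval (a : Gate d) {Q : Matrix (Fin de) (Fin de) ℝ}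
    (x : EuclideanSpace ℝ (Fin N × Fin d)) {e : Fin N → EuclideanSpace ℝ (Fin de)}
    (hQ : ∀ i, Q *ᵥ (e i) = e i) (φ : Fin 4 → ℝ) (f : Fin 5 → Fin N × Fin d → ℝ) :
    (a.head Q).eval (bufferTokens x e φ f) = bufferMatrix de (a.update x e φ f) := by
  set Y := bufferTokens x e φ f with hY
  have hQe : ∀ i p, ∑ q, Q p q * e i q = e i p := fun i p => congrFun (hQ i) p
  have hw : ∀ i j, ((gateQuery d Q * Y)ᵀ * (a.key Q * Y)) i j =
      a.lam * inner ℝ (e i) (e j) + a.b + a.g ⬝ᵥ φ := by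
    intro i j
    simp only [Matrix.mul_apply, Matrix.transpose_apply, Fintype.sum_sum_type, hY, bufferTokens,
      tokens, gateQuery, Gate.key, Matrix.of_apply, Sum.elim_inl, Sum.elim_inr, zero_mul, mul_zero,
      Finset.sum_const_zero, add_zero, zero_add, hQe, Finset.univ_unique, Finset.sum_singleton,
      mul_one, one_mul, PiLp.inner_apply, mul_assoc, ← Finset.mul_sum, dotProduct]
    simp only [mul_left_comm _ a.lam, ← Finset.mul_sum]
    simp [mul_comm]
    ring
  have hV : ∀ k i, (a.value de * Y) k i = Sum.elim (fun _ => 0) (Sum.elim (fun _ => 0)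
      (Sum.elim (fun _ => 0) (Sum.elim (fun p : Fin 5 × Fin d => if p.1 = a.dst then
        ∑ c, a.A p.2 c * a.source x f (i, c) else 0) (Sum.elim (fun _ => 0) fun _ => 0)))) k := by
    rintro (k | k | k | k | k | k) i <;>
    simp only [Matrix.mul_apply, Fintype.sum_sum_type, hY, bufferTokens,
      tokens, Gate.value, Matrix.of_apply, Sum.elim_inl, Sum.elim_inr, zero_mul,
      Finset.sum_const_zero, add_zero, zero_add]
    rcases h : a.src with _ | c
    · by_cases hk : k.1 = a.dst <;> simp [hk, Gate.source, h]
    · by_cases hk : k.1 = a.dst <;>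
        simp [hk, Gate.source, h, Fintype.sum_prod_type, Finset.sum_ite_irrel]
  ext k j
  rw [Head.eval, Matrix.mul_apply]
  simp only [Gate.head, Matrix.map_apply, hw, hV]
  rcases k with k | k | k | k | k | k <;>
    simp only [bufferMatrix, AddMonoidHom.coe_mk, ZeroHom.coe_mk, Matrix.of_apply, Sum.elim_inl,
      Sum.elim_inr, zero_mul, Finset.sum_const_zero]
  rw [Gate.update]
  by_cases hk : k.1 = a.dst
  · simp only [hk, if_true, Pi.single_eq_same, Matrix.mulVec, dotProduct, Fintype.sum_prod_type,
      Matrix.kroneckerMap_apply, Gate.weights, Matrix.of_apply, Finset.sum_mul]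
    exact Finset.sum_congr rfl fun i _ => Finset.sum_congr rfl fun c _ => by ring
  · simp [hk]

lemma Gate.frob_value (a : Gate d) (de : ℕ) : frob (a.value de) = frob a.A := by
  unfold frob
  congr 1
  simp only [Fintype.sum_sum_type, Gate.value, Matrix.of_apply, ne_eq, OfNat.ofNat_ne_zero,
    not_false_eq_true, zero_pow, Finset.sum_const_zero, add_zero, zero_add]
  rcases h : a.src with _ | c
  · simp [Fintype.sum_prod_type, Finset.sum_ite_irrel, ite_pow]
  · simp [Fintype.sum_prod_type, Finset.sum_ite_irrel, ite_pow, ite_and]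

lemma frob_gateQuery_le (d : ℕ) {Q : Matrix (Fin de) (Fin de) ℝ} {n : ℝ} (hn : 0 ≤ n)
    (hQ : ∑ a, ∑ b, Q a b ^ 2 ≤ n ^ 2) : frob (gateQuery d Q) ≤ n + 1 := by
  refine Real.sqrt_le_iff.2 ⟨by positivity, ?_⟩
  simp only [Fintype.sum_sum_type, gateQuery, Matrix.of_apply, ne_eq, OfNat.ofNat_ne_zero,
    not_false_eq_true, zero_pow, Finset.sum_const_zero, add_zero, zero_add, one_pow,
    Finset.univ_unique, Finset.sum_const, Finset.card_singleton, one_smul]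
  nlinarith

lemma Gate.frob_key_le (a : Gate d) {Q : Matrix (Fin de) (Fin de) ℝ} {n : ℝ} (hn : 0 ≤ n)
    (hQ : ∑ a, ∑ b, Q a b ^ 2 ≤ n ^ 2) (hg : ∑ i, a.g i ^ 2 ≤ 1) :
    frob (a.key Q) ≤ |a.lam| * n + |a.b| + 1 := by
  refine Real.sqrt_le_iff.2 ⟨by positivity, ?_⟩
  simp only [Fintype.sum_sum_type, Gate.key, Matrix.of_apply, ne_eq, OfNat.ofNat_ne_zero,
    not_false_eq_true, zero_pow, Finset.sum_const_zero, add_zero, zero_add, mul_pow,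
    Finset.univ_unique, Finset.sum_const, Finset.card_singleton, one_smul, ← Finset.mul_sum]
  have h1 := mul_le_mul_of_nonneg_left hQ (sq_nonneg a.lam)
  have h2 := sq_abs a.lam
  have h3 := sq_abs a.b
  have h4 : 0 ≤ |a.lam| * n := by positivity
  have h5 := mul_nonneg h4 (abs_nonneg a.b)
  nlinarith [abs_nonneg a.b]

/-- A block consisting of gates, with a trivial feedforward layer. -/
def gateBlock (Q : Matrix (Fin de) (Fin de) ℝ) (l : List (Gate d)) : Block (Coord d de) :=
  ⟨l.map fun a => a.head Q, 0, 0, 0, 0⟩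

lemma gateBlock_eval {Q : Matrix (Fin de) (Fin de) ℝ} (l : List (Gate d))
    (x : EuclideanSpace ℝ (Fin N × Fin d)) {e : Fin N → EuclideanSpace ℝ (Fin de)}
    (hQ : ∀ i, Q *ᵥ (e i) = e i) (φ : Fin 4 → ℝ) (f : Fin 5 → Fin N × Fin d → ℝ) :
    (gateBlock Q l).eval (bufferTokens x e φ f) =
      bufferTokens x e φ (f + (l.map fun a => a.update x e φ f).sum) := by
  have h1 : ∀ Z : Matrix (Coord d de) (Fin N) ℝ, (gateBlock Q l).ffn Z = Z := by
    intro Z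
    ext k i
    simp [Block.ffn, gateBlock]
  rw [Block.eval, h1, Block.attn, ← bufferTokens_add, map_list_sum, List.map_map]
  simp only [gateBlock, List.map_map]
  congr 2
  exact List.map_congr_left fun a _ => a.head_eval x hQ φ f

/-- Bounds for the weights of a gate, given a bound `n` for the Frobenius norm of the matrix `Q` in
its query and key. -/
structure Gate.Bounded (a : Gate d) (n B : ℝ) : Prop where
  value : frob a.A ≤ B
  key : |a.lam| * n + |a.b| + 1 ≤ B
  feature : ∑ i, a.g i ^ 2 ≤ 1

lemma gateBlock_bounded {Q : Matrix (Fin de) (Fin de) ℝ} {l : List (Gate d)} {n B : ℝ} {M : ℕ}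
    (hn : 0 ≤ n) (hQ : ∑ a, ∑ b, Q a b ^ 2 ≤ n ^ 2) (hnB : n + 1 ≤ B) (hM : l.length ≤ M)
    (hl : ∀ a ∈ l, a.Bounded n B) : (gateBlock Q l).Bounded M B := by
  have hB : 0 ≤ B := by linarith
  refine ⟨by simpa [gateBlock] using hM, ?_, ?_, ?_⟩
  · intro h hh
    obtain ⟨a, ha, rfl⟩ := List.mem_map.1 hh
    exact ⟨(a.frob_value de).le.trans (hl a ha).value, (frob_gateQuery_le d hn hQ).trans hnB,
      (a.frob_key_le hn hQ (hl a ha).feature).trans (hl a ha).key⟩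
  · simp [gateBlock, frob, hB]
  · simp [gateBlock, euclNorm, hB]

end Gates

variable {N d de : ℕ}

/-! ### The network that performs gradient descent -/

section Construction

lemma runBlocks_append {κ : Type} [Fintype κ] (l l' : List (Block κ)) (Y : Matrix κ (Fin N) ℝ) :
    runBlocks (l ++ l') Y = runBlocks l' (runBlocks l Y) := by
  simp [runBlocks, List.foldl_append]

lemma runBlocks_cons {κ : Type} [Fintype κ] (b : Block κ) (l : List (Block κ))
    (Y : Matrix κ (Fin N) ℝ) : runBlocks (b :: l) Y = runBlocks l (b.eval Y) := rfl

lemma runBlocks_nil {κ : Type} [Fintype κ] (Y : Matrix κ (Fin N) ℝ) :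
    runBlocks ([] : List (Block κ)) Y = Y := rfl

lemma inner_eq_of_norm_eq {E : Type*} [NormedAddCommGroup E] [InnerProductSpace ℝ E] {u v : E}
    {r : ℝ} (hu : ‖u‖ = r) (hv : ‖v‖ = r) : inner ℝ u v = r ^ 2 - ‖u - v‖ ^ 2 / 2 := by
  rw [norm_sub_sq_real, hu, hv]; ring

/-- A gate through which every token only attends to itself: the penalty `lam (⟪eᵢ, eⱼ⟫ - ρ)`
suppresses the other tokens, if `ρ` is the common squared norm of the time embeddings. It multiplies
the source exactly by `s (b + g ⬝ φ)`. -/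
def selfGate (src : Option (Fin 5)) (dst : Fin 5) (s lam ρ b : ℝ) (g : Fin 4 → ℝ) : Gate d :=
  ⟨src, dst, s • 1, lam, b - lam * ρ, g⟩

lemma selfGate_update {e : Fin N → EuclideanSpace ℝ (Fin de)} {r c : ℝ} (hc : 0 ≤ c)
    (hr : ∀ i, ‖e i‖ = r) (he : ∀ i j, i ≠ j → c ≤ ‖e i - e j‖) (src : Option (Fin 5))
    (dst : Fin 5) (s : ℝ) {lam b : ℝ} {g φ : Fin 4 → ℝ} (hlam : 0 ≤ lam) (h0 : 0 ≤ b + g ⬝ᵥ φ)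
    (h1 : b + g ⬝ᵥ φ ≤ lam * c ^ 2 / 2) (x : EuclideanSpace ℝ (Fin N × Fin d))
    (f : Fin 5 → Fin N × Fin d → ℝ) :
    (selfGate src dst s lam (r ^ 2) b g).update x e φ f =
      Pi.single dst (((b + g ⬝ᵥ φ) * s) • (src.elim (x : Fin N × Fin d → ℝ) f)) := by
  have hw : (selfGate (d := d) src dst s lam (r ^ 2) b g).weights e φ = (b + g ⬝ᵥ φ) • 1 := by
    ext j i
    rw [Gate.weights, Matrix.of_apply, Matrix.smul_apply, selfGate]
    rcases eq_or_ne j i with rfl | hij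
    · rw [Matrix.one_apply_eq, real_inner_self_eq_norm_sq, hr, relu, max_eq_left (by linarith)]
      simp only [smul_eq_mul]; ring
    · rw [Matrix.one_apply_ne hij, smul_zero, relu, max_eq_right]
      rw [inner_eq_of_norm_eq (hr i) (hr j)]
      have h2 : c ^ 2 ≤ ‖e i - e j‖ ^ 2 := by gcongr; exact he i j hij.symm
      nlinarith [mul_le_mul_of_nonneg_left h2 hlam]
  rw [Gate.update, hw]
  simp only [selfGate, Gate.source]
  rw [Matrix.smul_kronecker, Matrix.kronecker_smul, Matrix.one_kronecker_one, smul_smul,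
    Matrix.smul_mulVec, Matrix.one_mulVec]

/-- A gate that adds to the third buffer block the image of the first one under `relu` of the
(shifted) Gram matrix of the time embeddings, in time, and a multiple of `S`, in space. -/
def kernelGate (S : Matrix (Fin d) (Fin d) ℝ) (s lam b : ℝ) : Gate d :=
  ⟨some 0, 2, s • S, lam, b, 0⟩

/-- The blocks that apply a truncated temporal covariance: `v` lists the inner products of the time
embeddings, `w` the covariances, by time lag, and `J` is the cut-off lag. Each block adds one linear
piece of the interpolation of `w` as a function of `v`, so that two heads per block suffice; the
constant `w J` is left out. -/
def kernelBlocks (Q : Matrix (Fin de) (Fin de) ℝ) (S : Matrix (Fin d) (Fin d) ℝ) (v w : ℕ → ℝ)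
    (J : ℕ) : List (Block (Coord d de)) :=
  (List.range J).map fun k => gateBlock Q
    [kernelGate S ((w k - w (k + 1)) / (v k - v (k + 1))) 1 (-v (k + 1)),
      kernelGate S (-((w k - w (k + 1)) / (v k - v (k + 1)))) 1 (-v k)]

/-- The temporal covariance with the lags beyond `J` replaced by `J`. -/
def truncatedMatrix (N : ℕ) (w : ℕ → ℝ) (J : ℕ) : Matrix (Fin N) (Fin N) ℝ :=
  Matrix.of fun i j => w (min (Nat.dist i j) J)

lemma kernelBlocks_eval {Q : Matrix (Fin de) (Fin de) ℝ} {e : Fin N → EuclideanSpace ℝ (Fin de)}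
    (hQ : ∀ i, Q *ᵥ (e i) = e i) (S : Matrix (Fin d) (Fin d) ℝ) {v w : ℕ → ℝ}
    (hv : ∀ i j : Fin N, inner ℝ (e i) (e j) = v (Nat.dist i j))
    (J : ℕ) (x : EuclideanSpace ℝ (Fin N × Fin d)) (φ : Fin 4 → ℝ)
    (f : Fin 5 → Fin N × Fin d → ℝ) :
    runBlocks (kernelBlocks Q S v w J) (bufferTokens x e φ f) = bufferTokens x e φ
      (f + Pi.single 2 (((Matrix.of fun i j : Fin N => ∑ k ∈ Finset.range J,
        (w k - w (k + 1)) / (v k - v (k + 1)) * (relu (v (Nat.dist i j) - v (k + 1)) -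
          relu (v (Nat.dist i j) - v k))) ⊗ₖ S) *ᵥ f 0)) := by
  induction J with
  | zero =>
    have h : ((Matrix.of fun _ _ : Fin N => (0 : ℝ)) ⊗ₖ S) = 0 := by
      ext p q; simp
    simp [kernelBlocks, runBlocks_nil, h]
  | succ J ih =>
    rw [kernelBlocks, List.range_succ, List.map_append, runBlocks_append]
    rw [kernelBlocks] at ih
    rw [ih, List.map_singleton, runBlocks_cons, runBlocks_nil, gateBlock_eval _ _ hQ, add_assoc]
    congr 2
    simp only [List.map_cons, List.map_nil, List.sum_cons, List.sum_nil, add_zero, Gate.update,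
      kernelGate, Gate.source, Option.elim_some, ← Pi.single_add]
    congr 1
    have h0 : ∀ g : Fin N × Fin d → ℝ, (f + Pi.single (2 : Fin 5) g : Fin 5 → Fin N × Fin d → ℝ) 0
        = f 0 := by
      intro g; simp
    rw [h0, ← Matrix.add_mulVec, ← Matrix.add_mulVec]
    congr 1
    ext p q
    simp only [Matrix.add_apply, Matrix.kroneckerMap_apply, Matrix.of_apply, Gate.weights,
      Finset.sum_range_succ, Matrix.smul_apply, smul_eq_mul, hv, one_mul, zero_dotProduct,
      add_zero, Nat.dist_comm (q.1 : ℕ), ← sub_eq_add_neg]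
    ring

lemma vec_add_single {V : Type*} [AddCommMonoid V] (v₀ v₁ v₂ v₃ v₄ w : V) :
    ![v₀, v₁, v₂, v₃, v₄] + Pi.single 0 w = ![v₀ + w, v₁, v₂, v₃, v₄] ∧
    ![v₀, v₁, v₂, v₃, v₄] + Pi.single 1 w = ![v₀, v₁ + w, v₂, v₃, v₄] ∧
    ![v₀, v₁, v₂, v₃, v₄] + Pi.single 2 w = ![v₀, v₁, v₂ + w, v₃, v₄] ∧
    ![v₀, v₁, v₂, v₃, v₄] + Pi.single 3 w = ![v₀, v₁, v₂, v₃ + w, v₄] := by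
  refine ⟨?_, ?_, ?_, ?_⟩ <;> funext k <;> fin_cases k <;> simp

/-- The blocks that perform one gradient step `s ↦ s - (η / 4) (Φ s + z)` on the first buffer block
`s`, with `z` in the second one. The third buffer block collects `(Γ ⊗ Σ) s`, for the truncated `Γ`,
the fourth one `Φ s + z`; both are zero before and after. -/
def stepBlocks (Q : Matrix (Fin de) (Fin de) ℝ) (S : Matrix (Fin d) (Fin d) ℝ) (v w : ℕ → ℝ)
    (J : ℕ) (lam ρ : ℝ) : List (Block (Coord d de)) :=
  kernelBlocks Q S v w J ++ [gateBlock Q [kernelGate S (w J) 0 1],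
    gateBlock Q [selfGate (some 2) 3 1 lam ρ 0 (Pi.single 3 1),
      selfGate (some 0) 3 1 lam ρ 0 (Pi.single 2 1), selfGate (some 1) 3 1 lam ρ 1 0,
      selfGate (some 2) 2 (-1) lam ρ 1 0],
    gateBlock Q [selfGate (some 3) 0 (-1 / 4) lam ρ 0 (Pi.single 0 1),
      selfGate (some 3) 3 (-1) lam ρ 1 0]]

lemma stepBlocks_eval {Q : Matrix (Fin de) (Fin de) ℝ} {e : Fin N → EuclideanSpace ℝ (Fin de)}
    (hQ : ∀ i, Q *ᵥ (e i) = e i) (S : Matrix (Fin d) (Fin d) ℝ) {v w : ℕ → ℝ}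
    (hv : ∀ i j : Fin N, inner ℝ (e i) (e j) = v (Nat.dist i j))
    (hanti : StrictAntiOn v (Set.Iio N)) {J : ℕ} (hJ : J < N) {r c lam : ℝ} (hc : 0 ≤ c)
    (hr : ∀ i, ‖e i‖ = r) (he : ∀ i j, i ≠ j → c ≤ ‖e i - e j‖) (hlam : 0 ≤ lam)
    (hone : 1 ≤ lam * c ^ 2 / 2) {φ : Fin 4 → ℝ} (hφ0 : ∀ k, 0 ≤ φ k)
    (hφ : ∀ k, φ k ≤ lam * c ^ 2 / 2)
    (x : EuclideanSpace ℝ (Fin N × Fin d)) (s z μ : Fin N × Fin d → ℝ) :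
    runBlocks (stepBlocks Q S v w J lam (r ^ 2)) (bufferTokens x e φ ![s, z, 0, 0, μ]) =
      bufferTokens x e φ ![s - (φ 0 / 4) • ((φ 3 • (truncatedMatrix N w J ⊗ₖ S) +
        φ 2 • (1 : Matrix (Fin N × Fin d) (Fin N × Fin d) ℝ)) *ᵥ s + z), z, 0, 0, μ] := by
  have hone' : ∀ (src : Option (Fin 5)) (dst : Fin 5) (s : ℝ) f,
      (selfGate src dst s lam (r ^ 2) 1 0).update x e φ f =
        Pi.single dst (s • (src.elim (x : Fin N × Fin d → ℝ) f)) := by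
    intro src dst s f
    rw [selfGate_update hc hr he _ _ _ hlam (by simp) (by simpa using hone)]
    simp
  have hfeat : ∀ (src : Option (Fin 5)) (dst : Fin 5) (s : ℝ) (k : Fin 4) f,
      (selfGate src dst s lam (r ^ 2) 0 (Pi.single k 1)).update x e φ f =
        Pi.single dst ((φ k * s) • (src.elim (x : Fin N × Fin d → ℝ) f)) := by
    intro src dst s k f
    rw [selfGate_update hc hr he _ _ _ hlam (by simpa using hφ0 k) (by simpa using hφ k)]
    simp
  have hker : ∀ f, (kernelGate S (w J) 0 1).update x e φ f =
      Pi.single 2 (((Matrix.of fun _ _ : Fin N => w J) ⊗ₖ S) *ᵥ f 0) := by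
    intro f
    rw [Gate.update]
    simp only [kernelGate, Gate.source, Option.elim_some]
    congr 2
    ext p q
    simp [Gate.weights, relu]
  rw [stepBlocks, runBlocks_append, kernelBlocks_eval hQ S hv]
  simp only [runBlocks_cons, runBlocks_nil, gateBlock_eval _ _ hQ, List.map_cons, List.map_nil,
    List.sum_cons, List.sum_nil, add_zero, hone', hfeat, hker]
  set W := (Matrix.of fun i j : Fin N => ∑ k ∈ Finset.range J,
        (w k - w (k + 1)) / (v k - v (k + 1)) * (relu (v (Nat.dist i j) - v (k + 1)) -
          relu (v (Nat.dist i j) - v k))) with hW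
  have hsum : truncatedMatrix N w J ⊗ₖ S =
      W ⊗ₖ S + (Matrix.of fun _ _ : Fin N => w J) ⊗ₖ S := by
    ext p q
    have hd : Nat.dist p.1 q.1 < N := by
      have := p.1.isLt; have := q.1.isLt
      simp only [Nat.dist]; omega
    have := interpolation (g := w) hanti hJ hd
    simp only [truncatedMatrix, Matrix.kroneckerMap_apply, Matrix.of_apply, Matrix.add_apply, hW,
      ← this]
    ring
  simp only [← add_assoc, (vec_add_single _ _ _ _ _ _).1,
    (vec_add_single _ _ _ _ _ _).2.2.1, (vec_add_single _ _ _ _ _ _).2.2.2, Option.elim_some,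
    Matrix.cons_val, zero_add]
  rw [hsum]
  simp only [Matrix.add_mulVec, Matrix.smul_mulVec, Matrix.one_mulVec]
  congr 2
  · module
  · congr 2
    · module
    · congr 1
      module

/-- The blocks that write `x - α μ` into the second buffer block, with `μ` in the fifth one. -/
def centerBlock (Q : Matrix (Fin de) (Fin de) ℝ) (lam ρ : ℝ) : Block (Coord d de) :=
  gateBlock Q [selfGate none 1 1 lam ρ 1 0, selfGate (some 4) 1 (-1) lam ρ 0 (Pi.single 1 1)]

lemma centerBlock_eval {Q : Matrix (Fin de) (Fin de) ℝ} {e : Fin N → EuclideanSpace ℝ (Fin de)}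
    (hQ : ∀ i, Q *ᵥ (e i) = e i) {r c lam : ℝ} (hc : 0 ≤ c)
    (hr : ∀ i, ‖e i‖ = r) (he : ∀ i j, i ≠ j → c ≤ ‖e i - e j‖) (hlam : 0 ≤ lam)
    (hone : 1 ≤ lam * c ^ 2 / 2) {φ : Fin 4 → ℝ} (hφ0 : ∀ k, 0 ≤ φ k)
    (hφ : ∀ k, φ k ≤ lam * c ^ 2 / 2)
    (x : EuclideanSpace ℝ (Fin N × Fin d)) (μ : Fin N × Fin d → ℝ) :
    (centerBlock Q lam (r ^ 2)).eval (bufferTokens x e φ ![0, 0, 0, 0, μ]) =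
      bufferTokens x e φ ![0, (x : Fin N × Fin d → ℝ) - φ 1 • μ, 0, 0, μ] := by
  rw [centerBlock, gateBlock_eval _ _ hQ]
  simp only [List.map_cons, List.map_nil, List.sum_cons, List.sum_nil, add_zero]
  rw [selfGate_update hc hr he _ _ _ hlam (by simp) (by simpa using hone),
    selfGate_update hc hr he _ _ _ hlam (by simpa using hφ0 1) (by simpa using hφ 1),
    ← add_assoc, (vec_add_single _ _ _ _ _ _).2.1, (vec_add_single _ _ _ _ _ _).2.1]
  congr 3
  simp
  module

/-- All blocks after the mean network: centering, then `K` gradient steps. -/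
def descentBlocks (Q : Matrix (Fin de) (Fin de) ℝ) (S : Matrix (Fin d) (Fin d) ℝ) (v w : ℕ → ℝ)
    (J : ℕ) (lam ρ : ℝ) (K : ℕ) : List (Block (Coord d de)) :=
  centerBlock Q lam ρ :: (List.replicate K (stepBlocks Q S v w J lam ρ)).flatten

lemma descentBlocks_length (Q : Matrix (Fin de) (Fin de) ℝ) (S : Matrix (Fin d) (Fin d) ℝ)
    (v w : ℕ → ℝ) (J : ℕ) (lam ρ : ℝ) (K : ℕ) :
    (descentBlocks Q S v w J lam ρ K).length = K * (J + 3) + 1 := by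
  simp [descentBlocks, stepBlocks, kernelBlocks]

/-- The transformer performs gradient descent, with the truncated temporal covariance. -/
lemma descentBlocks_eval {Q : Matrix (Fin de) (Fin de) ℝ} {e : Fin N → EuclideanSpace ℝ (Fin de)}
    (hQ : ∀ i, Q *ᵥ (e i) = e i) (S : Matrix (Fin d) (Fin d) ℝ) {v w : ℕ → ℝ}
    (hv : ∀ i j : Fin N, inner ℝ (e i) (e j) = v (Nat.dist i j))
    (hanti : StrictAntiOn v (Set.Iio N)) {J : ℕ} (hJ : J < N) {r c lam : ℝ} (hc : 0 ≤ c)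
    (hr : ∀ i, ‖e i‖ = r) (he : ∀ i j, i ≠ j → c ≤ ‖e i - e j‖) (hlam : 0 ≤ lam)
    (hone : 1 ≤ lam * c ^ 2 / 2) {φ : Fin 4 → ℝ} (hφ0 : ∀ k, 0 ≤ φ k)
    (hφ : ∀ k, φ k ≤ lam * c ^ 2 / 2)
    (x μ : EuclideanSpace ℝ (Fin N × Fin d)) (K : ℕ) :
    extract (runBlocks (descentBlocks Q S v w J lam (r ^ 2) K)
      (bufferTokens x e φ ![0, 0, 0, 0, μ.ofLp])) =
      descent (Matrix.toEuclideanCLM (𝕜 := ℝ) (φ 3 • (truncatedMatrix N w J ⊗ₖ S) +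
        φ 2 • (1 : Matrix (Fin N × Fin d) (Fin N × Fin d) ℝ)) :
          EuclideanSpace ℝ (Fin N × Fin d) →ₗ[ℝ] EuclideanSpace ℝ (Fin N × Fin d))
        (φ 0 / 4) (x - φ 1 • μ) K := by
  set Φ := φ 3 • (truncatedMatrix N w J ⊗ₖ S) +
        φ 2 • (1 : Matrix (Fin N × Fin d) (Fin N × Fin d) ℝ) with hΦ
  have h : ∀ K, runBlocks (descentBlocks Q S v w J lam (r ^ 2) K)
      (bufferTokens x e φ ![0, 0, 0, 0, μ.ofLp]) = bufferTokens x e φ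
        ![(descent (Matrix.toEuclideanCLM (𝕜 := ℝ) Φ :
          EuclideanSpace ℝ (Fin N × Fin d) →ₗ[ℝ] EuclideanSpace ℝ (Fin N × Fin d))
          (φ 0 / 4) (x - φ 1 • μ) K).ofLp, x.ofLp - φ 1 • μ.ofLp, 0, 0, μ.ofLp] := by
    intro K
    induction K with
    | zero =>
      rw [descentBlocks, runBlocks_cons, List.replicate_zero, List.flatten_nil, runBlocks_nil,
        centerBlock_eval hQ hc hr he hlam hone hφ0 hφ, descent, WithLp.ofLp_zero]
    | succ K ih =>
      rw [descentBlocks, runBlocks_cons, List.replicate_succ', List.flatten_append,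
        runBlocks_append, ← runBlocks_cons, ← descentBlocks, ih]
      simp only [List.flatten_cons, List.flatten_nil, List.append_nil]
      rw [stepBlocks_eval hQ S hv hanti hJ hc hr he hlam hone hφ0 hφ, descent]
      rfl
  rw [h K]
  rfl

end Construction

/-! ### Error of the clipped iterate -/

section Error

lemma norm_clip_le {n : Type*} [Fintype n] (R : ℝ) (s : EuclideanSpace ℝ n) (hR : 0 ≤ R) :
    ‖clip R s‖ ≤ ‖s‖ := by
  unfold clip
  split_ifs with h
  · exact le_rfl
  · push Not at h
    have h0 : 0 < ‖s‖ := hR.trans_lt h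
    rw [norm_smul, Real.norm_of_nonneg (by positivity), div_mul_cancel₀ _ h0.ne']
    exact h.le

lemma measurable_clip {n : Type*} [Fintype n] (R : ℝ) :
    Measurable (clip R : EuclideanSpace ℝ n → EuclideanSpace ℝ n) := by
  unfold clip
  refine Measurable.ite (measurableSet_le measurable_norm measurable_const) measurable_id ?_
  exact (measurable_const.div measurable_norm).smul measurable_id

/-- Clipping at a radius `R` that exceeds `2 √q / σ` is harmless; beyond, the Gaussian tail is
controlled by `exp (q / 4)`. -/
lemma sq_norm_clip_sub_le {n : Type*} [Fintype n] {s y : EuclideanSpace ℝ n} {σ q κ R : ℝ}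
    (hσ : 0 < σ) (hR : 0 ≤ R) (hq : 0 ≤ q) (hy : σ * ‖y‖ ≤ Real.sqrt q)
    (hκ : κ ≤ 1) (hs : σ * ‖s + y‖ ≤ κ * Real.sqrt q) :
    ‖clip R s - -y‖ ^ 2 ≤
      (κ ^ 2 * q + 72 * Real.exp (-(R ^ 2 * σ ^ 2 / 32)) * Real.exp (q / 4)) / σ ^ 2 := by
  rw [le_div_iff₀ (by positivity), ← mul_pow, sub_neg_eq_add, mul_comm _ σ]
  have hsq := Real.sq_sqrt hq
  have hsq0 := Real.sqrt_nonneg q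
  have hnorm : σ * ‖s‖ ≤ 2 * Real.sqrt q := by
    have h1 : ‖s‖ ≤ ‖s + y‖ + ‖y‖ := by
      simpa using norm_sub_le (s + y) y
    have h2 : κ * Real.sqrt q ≤ Real.sqrt q := by nlinarith
    nlinarith
  by_cases h : 2 * Real.sqrt q ≤ R * σ
  · have h1 : ‖s‖ ≤ R := by
      refine le_of_mul_le_mul_left ?_ hσ
      linarith
    have h2 : clip R s = s := by rw [clip, if_pos h1]
    rw [h2]
    have h3 : (σ * ‖s + y‖) ^ 2 ≤ κ ^ 2 * q := by
      calc _ ≤ (κ * Real.sqrt q) ^ 2 := by gcongr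
        _ = _ := by rw [mul_pow, hsq]
    have := Real.exp_pos (-(R ^ 2 * σ ^ 2 / 32))
    have := Real.exp_pos (q / 4)
    nlinarith [mul_pos (Real.exp_pos (-(R ^ 2 * σ ^ 2 / 32))) (Real.exp_pos (q / 4))]
  · push Not at h
    have h1 : σ * ‖clip R s + y‖ ≤ 3 * Real.sqrt q := by
      have h2 := norm_add_le (clip R s) y
      have h3 := norm_clip_le R s hR
      nlinarith
    have h4 : R ^ 2 * σ ^ 2 ≤ 4 * q := by
      have h5 : 0 ≤ R * σ := by positivity
      nlinarith
    have h6 : q ≤ 8 * (Real.exp (-(R ^ 2 * σ ^ 2 / 32)) * Real.exp (q / 4)) := by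
      rw [← Real.exp_add]
      have h7 := Real.add_one_le_exp (-(R ^ 2 * σ ^ 2 / 32) + q / 4)
      linarith
    calc (σ * ‖clip R s + y‖) ^ 2 ≤ (3 * Real.sqrt q) ^ 2 := by gcongr
      _ = 9 * q := by rw [mul_pow, hsq]; norm_num
      _ ≤ 9 * (8 * (Real.exp (-(R ^ 2 * σ ^ 2 / 32)) * Real.exp (q / 4))) := by gcongr
      _ ≤ _ := by nlinarith [mul_nonneg (sq_nonneg κ) hq]

variable {N d : ℕ}

lemma isSymmetric_toEuclideanCLM {n : Type*} [Fintype n] [DecidableEq n] {A : Matrix n n ℝ}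
    (hA : A.IsHermitian) : ((Matrix.toEuclideanCLM (𝕜 := ℝ) A :
      EuclideanSpace ℝ n →L[ℝ] EuclideanSpace ℝ n) :
      EuclideanSpace ℝ n →ₗ[ℝ] EuclideanSpace ℝ n).IsSymmetric :=
  (IsSelfAdjoint.map (f := Matrix.toEuclideanCLM (𝕜 := ℝ)) hA).isSymmetric

lemma norm_sq_eq_dotProduct {n : Type*} [Fintype n] (x : EuclideanSpace ℝ n) :
    ‖x‖ ^ 2 = x.ofLp ⬝ᵥ x.ofLp := by
  rw [EuclideanSpace.real_norm_sq_eq]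
  simp [dotProduct, sq]

lemma isHermitian_diffusedCov {Γ : Matrix (Fin N) (Fin N) ℝ} {S : Matrix (Fin d) (Fin d) ℝ}
    (hΓ : Γ.IsHermitian) (hS : S.IsHermitian) (t : ℝ) : (diffusedCov Γ S t).IsHermitian := by
  refine isHermitian_smul_add ?_ _ _
  rw [Matrix.IsHermitian, Matrix.conjTranspose_kronecker, hΓ.eq, hS.eq]

/-- Accuracy of gradient descent for the score, with an entrywise perturbation `Γ'` of the temporal
covariance `Γ`. A quarter of the step size `2 / (λ_max + λ_min)` of the exact Hessian is at most the
inverse of `3 / 2 * λ_max`, which bounds the perturbed Hessian. -/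
lemma norm_descent_score_le [Nonempty (Fin N × Fin d)] {Γ Γ' : Matrix (Fin N) (Fin N) ℝ}
    {S : Matrix (Fin d) (Fin d) ℝ} (hG : (Γ ⊗ₖ S).PosSemidef) (hS : S.PosSemidef)
    (hΓ' : Γ'.IsHermitian) {ε δ : ℝ} (hε : 0 < ε)
    (hΓ : ∀ x, ε * (x ⬝ᵥ x) ≤ x ⬝ᵥ Γ *ᵥ x) (hδ0 : 0 ≤ δ) (hδ : ∀ i j, |Γ' i j - Γ i j| ≤ δ)
    (hτ : N * δ / ε ≤ 1 / 2) {t : ℝ} (ht : 0 < t) (y : EuclideanSpace ℝ (Fin N × Fin d)) (K : ℕ) :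
    sigma t * ‖descent (Matrix.toEuclideanCLM (𝕜 := ℝ) (diffusedCov Γ' S t) :
          EuclideanSpace ℝ (Fin N × Fin d) →ₗ[ℝ] EuclideanSpace ℝ (Fin N × Fin d))
        (stepSize Γ S t / 4) (Matrix.toEuclideanCLM (𝕜 := ℝ) (diffusedCov Γ S t) y) K + y‖ ≤
      (2 * Real.exp (-(K / (16 * condNumber (diffusedCov Γ S t)))) + 2 * (N * δ / ε)) *
        Real.sqrt (inner ℝ y (Matrix.toEuclideanCLM (𝕜 := ℝ) (diffusedCov Γ S t) y)) := by
  set Φ := diffusedCov Γ S t with hΦ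
  set Φ' := diffusedCov Γ' S t with hΦ'
  set τ : ℝ := N * δ / ε with hτdef
  have hτ0 : 0 ≤ τ := by positivity
  have hσ := sigma_pos ht
  have hH : Φ.IsHermitian := isHermitian_smul_add hG.1 _ _
  have hlo := sigma_sq_le_eigMin hG t
  rw [← hΦ] at hlo
  have hmin : 0 < eigMin Φ := (pow_pos hσ 2).trans_le hlo
  have hmm := eigMin_le_eigMax hH
  -- `A` and `B` are opaque, since unfolding the matrix operators is expensive.
  obtain ⟨A, hAe⟩ : ∃ A : EuclideanSpace ℝ (Fin N × Fin d) →ₗ[ℝ] EuclideanSpace ℝ (Fin N × Fin d),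
      A = Matrix.toEuclideanCLM (𝕜 := ℝ) Φ := ⟨_, rfl⟩
  obtain ⟨B, hBe⟩ : ∃ B : EuclideanSpace ℝ (Fin N × Fin d) →ₗ[ℝ] EuclideanSpace ℝ (Fin N × Fin d),
      B = Matrix.toEuclideanCLM (𝕜 := ℝ) Φ' := ⟨_, rfl⟩
  have hA : ∀ u v, inner ℝ u (A v) = u.ofLp ⬝ᵥ Φ *ᵥ v.ofLp := fun u v => by
    rw [hAe, ContinuousLinearMap.coe_coe, Matrix.inner_toEuclideanCLM]
  have hB : ∀ u v, inner ℝ u (B v) = u.ofLp ⬝ᵥ Φ' *ᵥ v.ofLp := fun u v => by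
    rw [hBe, ContinuousLinearMap.coe_coe, Matrix.inner_toEuclideanCLM]
  have hBs : B.IsSymmetric := by
    rw [hBe]
    exact isSymmetric_toEuclideanCLM (isHermitian_diffusedCov hΓ' hS.1 t)
  rw [← hBe]
  change sigma t * ‖descent B (stepSize Γ S t / 4) ((Matrix.toEuclideanCLM (𝕜 := ℝ) Φ :
    EuclideanSpace ℝ (Fin N × Fin d) →ₗ[ℝ] EuclideanSpace ℝ (Fin N × Fin d)) y) K + y‖ ≤
      _ * Real.sqrt (inner ℝ y ((Matrix.toEuclideanCLM (𝕜 := ℝ) Φ :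
        EuclideanSpace ℝ (Fin N × Fin d) →ₗ[ℝ] EuclideanSpace ℝ (Fin N × Fin d)) y))
  rw [← hAe]
  have hrel : ∀ u v, inner ℝ u (B v - A v) ^ 2 ≤
      τ ^ 2 * (inner ℝ u (A u) * inner ℝ v (A v)) := by
    intro u v
    rw [inner_sub_right, hA, hB, hA, hA, ← dotProduct_sub]
    exact sq_dotProduct_perturbation_le hS hε hΓ hδ t _ _
  have hlow : ∀ u, eigMin Φ * ‖u‖ ^ 2 ≤ inner ℝ u (A u) := by
    intro u
    rw [hA, norm_sq_eq_dotProduct]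
    exact eigMin_mul_le hH _
  have hup : ∀ u, inner ℝ u (A u) ≤ eigMax Φ * ‖u‖ ^ 2 := by
    intro u
    rw [hA, norm_sq_eq_dotProduct]
    exact le_eigMax_mul hH _
  have hquad : ∀ u, |inner ℝ u (B u) - inner ℝ u (A u)| ≤ τ * inner ℝ u (A u) := by
    intro u
    have h1 : 0 ≤ inner ℝ u (A u) := (by positivity : (0 : ℝ) ≤ _).trans (hlow u)
    refine abs_le_of_sq_le_sq ?_ (mul_nonneg hτ0 h1)
    rw [mul_pow, sq (inner ℝ u (A u)), ← inner_sub_right]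
    exact hrel u u
  have hη : stepSize Γ S t / 4 = 1 / (2 * (eigMax Φ + eigMin Φ)) := by
    rw [stepSize, ← hΦ]; field_simp; norm_num
  have hsum : 0 < eigMax Φ + eigMin Φ := by linarith
  have hBlow : ∀ u, eigMin Φ / 2 * ‖u‖ ^ 2 ≤ inner ℝ u (B u) := fun u => by
    have h1 := (abs_le.1 (hquad u)).1
    have h2 := hlow u
    have h3 : 0 ≤ eigMin Φ * ‖u‖ ^ 2 := by positivity
    have h4 : τ * inner ℝ u (A u) ≤ 1 / 2 * inner ℝ u (A u) :=
      mul_le_mul_of_nonneg_right hτ (h3.trans h2)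
    linarith
  have hBup : ∀ u, inner ℝ u (B u) ≤ 3 / 2 * eigMax Φ * ‖u‖ ^ 2 := fun u => by
    have h1 := (abs_le.1 (hquad u)).2
    have h2 := hlow u
    have h3 : 0 ≤ eigMin Φ * ‖u‖ ^ 2 := by positivity
    have h4 : τ * inner ℝ u (A u) ≤ 1 / 2 * inner ℝ u (A u) :=
      mul_le_mul_of_nonneg_right hτ (h3.trans h2)
    have h5 := hup u
    linarith
  have key := norm_descent_add_le (A := A) (η := stepSize Γ S t / 4) hBs hτ0 hτ hσ
    (fun u => (mul_le_mul_of_nonneg_right hlo (sq_nonneg _)).trans (hlow u)) hrel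
    (half_pos hmin) hBlow hBup (by rw [hη]; positivity)
    (by
      rw [hη, div_mul_eq_mul_div, div_le_one (by positivity)]
      linarith) y K
  refine key.trans ?_
  refine mul_le_mul_of_nonneg_right ?_ (Real.sqrt_nonneg _)
  gcongr
  rw [← Real.exp_nat_mul]
  refine Real.exp_le_exp.2 ?_
  rw [mul_neg, neg_le_neg_iff, hη, condNumber, div_eq_mul_inv]
  refine mul_le_mul_of_nonneg_left ?_ (Nat.cast_nonneg K)
  rw [inv_le_iff_one_le_mul₀ (by have := hmin.trans_le hmm; positivity)]
  field_simp
  linarith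

/-- The mean squared error of a clipped approximation `s` of the score. -/
lemma integral_clip_sub_score_le {n : Type*} [Fintype n] [DecidableEq n] [Nonempty n]
    (m : EuclideanSpace ℝ n) {G : Matrix n n ℝ} (hG : G.PosSemidef) {t : ℝ} (ht : 0 < t)
    {s : EuclideanSpace ℝ n → EuclideanSpace ℝ n} (hsm : Measurable s) {κ R : ℝ}
    (hR : 0 ≤ R) (hκ : κ ≤ 1)
    (hs : ∀ y, sigma t * ‖s (alpha t • m + Matrix.toEuclideanCLM (𝕜 := ℝ)
      (alpha t ^ 2 • G + sigma t ^ 2 • (1 : Matrix n n ℝ)) y) + y‖ ≤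
      κ * Real.sqrt (inner ℝ y (Matrix.toEuclideanCLM (𝕜 := ℝ)
        (alpha t ^ 2 • G + sigma t ^ 2 • (1 : Matrix n n ℝ)) y))) :
    Integrable (fun x => ‖clip R (s x) - score (multivariateGaussian m G) t x‖ ^ 2 *
      diffusedDensity (multivariateGaussian m G) t x) ∧
    ∫ x, ‖clip R (s x) - score (multivariateGaussian m G) t x‖ ^ 2 *
      diffusedDensity (multivariateGaussian m G) t x ≤
      (κ ^ 2 * (8 * Fintype.card n) +
        72 * Real.exp (-(R ^ 2 * sigma t ^ 2 / 32)) * Real.exp (Fintype.card n / 2)) /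
          sigma t ^ 2 := by
  have hσ := sigma_pos ht
  set Φ := alpha t ^ 2 • G + sigma t ^ 2 • (1 : Matrix n n ℝ) with hΦ
  have hΦpos : Φ.PosDef := by
    refine Matrix.PosDef.posSemidef_add (hG.smul (by positivity)) ?_
    exact Matrix.PosDef.one.smul (by positivity)
  have hdet := (Matrix.isUnit_iff_isUnit_det _).1 hΦpos.isUnit
  obtain ⟨K, hK, hp⟩ := diffusedDensity_multivariateGaussian m hG ht
  rw [← hΦ] at hp
  obtain ⟨hint, h1⟩ := integral_diffusedDensity (multivariateGaussian m G) ht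
  set p := diffusedDensity (multivariateGaussian m G) t with hpdef
  set b := alpha t • m
  set q : EuclideanSpace ℝ n → ℝ := fun z => inner ℝ z (Matrix.toEuclideanCLM (𝕜 := ℝ) Φ⁻¹ z)
    with hq
  have hqs : ∀ (c : ℝ) x, q (c • x) = c ^ 2 * q x := by
    intro c x
    simp only [hq, map_smul, real_inner_smul_left, real_inner_smul_right]
    ring
  have hq0 : ∀ x, 0 ≤ q x := by
    intro x
    simp only [hq, Matrix.inner_toEuclideanCLM]
    have := hΦpos.inv.posSemidef.dotProduct_mulVec_nonneg x.ofLp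
    simpa using this
  have hqc : Continuous q := by simp only [hq]; fun_prop
  obtain ⟨⟨hi1, hle1⟩, hi2, hle2⟩ := integral_quad_le hqs hq0 hqc hK hp hint h1 Fintype.card_pos
  have hscore : ∀ x, score (multivariateGaussian m G) t x =
      -Matrix.toEuclideanCLM (𝕜 := ℝ) Φ⁻¹ (x - b) := score_eq hK hΦpos.inv.1 hp
  have hp0 : ∀ x, 0 ≤ p x := fun x => by rw [hp]; positivity
  have hpt : ∀ x, ‖clip R (s x) - score (multivariateGaussian m G) t x‖ ^ 2 ≤
      (κ ^ 2 * q (x - b) + 72 * Real.exp (-(R ^ 2 * sigma t ^ 2 / 32)) *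
        Real.exp (q (x - b) / 4)) / sigma t ^ 2 := by
    intro x
    set y := Matrix.toEuclideanCLM (𝕜 := ℝ) Φ⁻¹ (x - b) with hy
    have hzy : Matrix.toEuclideanCLM (𝕜 := ℝ) Φ y = x - b := by
      rw [hy, ← ContinuousLinearMap.comp_apply, ← ContinuousLinearMap.mul_def, ← map_mul,
        Matrix.mul_nonsing_inv _ hdet, map_one]
      rfl
    have hqy : inner ℝ y (Matrix.toEuclideanCLM (𝕜 := ℝ) Φ y) = q (x - b) := by
      rw [hzy, real_inner_comm]
    have h2 := hs y
    rw [hqy, hzy, add_sub_cancel] at h2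
    rw [hscore]
    refine sq_norm_clip_sub_le hσ hR (hq0 _) ?_ hκ h2
    refine Real.le_sqrt_of_sq_le ?_
    rw [← hqy, hΦ, map_add, map_smul, map_smul, map_one, add_apply,
      inner_add_right, mul_pow]
    have h3 : inner ℝ y ((sigma t ^ 2 • (1 : EuclideanSpace ℝ n →L[ℝ] EuclideanSpace ℝ n)) y) =
        sigma t ^ 2 * ‖y‖ ^ 2 := by
      rw [smul_apply, one_apply_eq_self, real_inner_smul_right,
        real_inner_self_eq_norm_sq]
    have h4 : 0 ≤ inner ℝ y ((alpha t ^ 2 • Matrix.toEuclideanCLM (𝕜 := ℝ) G) y) := by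
      rw [smul_apply, real_inner_smul_right, Matrix.inner_toEuclideanCLM]
      have := hG.dotProduct_mulVec_nonneg y.ofLp
      have h5 : 0 ≤ y.ofLp ⬝ᵥ G *ᵥ y.ofLp := by simpa using this
      have h6 : (0 : ℝ) ≤ alpha t ^ 2 := sq_nonneg _
      simpa using mul_nonneg h6 h5
    rw [h3]
    linarith
  have hbound : ∀ x, ‖clip R (s x) - score (multivariateGaussian m G) t x‖ ^ 2 * p x ≤
      (κ ^ 2 * (q (x - b) * p x) + 72 * Real.exp (-(R ^ 2 * sigma t ^ 2 / 32)) *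
        (Real.exp (q (x - b) / 4) * p x)) / sigma t ^ 2 := by
    intro x
    refine (mul_le_mul_of_nonneg_right (hpt x) (hp0 x)).trans (le_of_eq ?_)
    ring
  have hdom : Integrable fun x => (κ ^ 2 * (q (x - b) * p x) +
      72 * Real.exp (-(R ^ 2 * sigma t ^ 2 / 32)) *
        (Real.exp (q (x - b) / 4) * p x)) / sigma t ^ 2 :=
    ((hi1.const_mul _).add (hi2.const_mul _)).div_const _
  have hmeas : Measurable fun x =>
      ‖clip R (s x) - score (multivariateGaussian m G) t x‖ ^ 2 * p x := by
    have hcs : score (multivariateGaussian m G) t =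
      fun x => -Matrix.toEuclideanCLM (𝕜 := ℝ) Φ⁻¹ (x - b) := funext hscore
    have hcp : p = fun x => K * Real.exp (-(q (x - b) / 2)) := funext hp
    rw [hcs, hcp]
    have hc := (measurable_clip (n := n) R).comp hsm
    refine Measurable.mul ?_ (Continuous.measurable (by fun_prop))
    refine Measurable.pow_const (Measurable.norm (Measurable.sub hc ?_)) 2
    exact Continuous.measurable (by fun_prop)
  have hI : Integrable fun x =>
      ‖clip R (s x) - score (multivariateGaussian m G) t x‖ ^ 2 * p x := by
    refine hdom.mono' hmeas.aestronglyMeasurable (Filter.Eventually.of_forall fun x => ?_)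
    rw [Real.norm_of_nonneg (mul_nonneg (sq_nonneg _) (hp0 x))]
    exact hbound x
  refine ⟨hI, (integral_mono hI hdom hbound).trans ?_⟩
  rw [integral_div, integral_add (hi1.const_mul _) (hi2.const_mul _), integral_const_mul,
    integral_const_mul]
  gcongr

end Error

/-! ### Bounds for the weights -/

section Bounds

variable {N d de : ℕ}

lemma frob_smul {m n : Type*} [Fintype m] [Fintype n] (s : ℝ) (A : Matrix m n ℝ) :
    frob (s • A) = |s| * frob A := by
  rw [frob, frob, ← Real.sqrt_sq_eq_abs, ← Real.sqrt_mul (sq_nonneg _)]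
  simp [mul_pow, Finset.mul_sum]

lemma frob_one : frob (1 : Matrix (Fin d) (Fin d) ℝ) = Real.sqrt d := by
  rw [frob]
  congr 1
  simp [Matrix.one_apply]

lemma frob_le_maxAbs (S : Matrix (Fin d) (Fin d) ℝ) : frob S ≤ d * maxAbs S := by
  have h : ∀ i j, |S i j| ≤ maxAbs S := fun i j =>
    le_ciSup (f := fun p : Fin d × Fin d => |S p.1 p.2|) (Set.finite_range _).bddAbove (i, j)
  have h0 : 0 ≤ maxAbs S := Real.iSup_nonneg fun _ => abs_nonneg _
  refine Real.sqrt_le_iff.2 ⟨by positivity, ?_⟩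
  calc ∑ i, ∑ j, S i j ^ 2 ≤ ∑ _i : Fin d, ∑ _j : Fin d, maxAbs S ^ 2 := by
        refine Finset.sum_le_sum fun i _ => Finset.sum_le_sum fun j _ => ?_
        rw [← sq_abs]
        exact pow_le_pow_left₀ (abs_nonneg _) (h i j) 2
    _ = _ := by simp; ring

lemma selfGate_bounded (src : Option (Fin 5)) (dst : Fin 5) {s lam ρ b n B : ℝ} {g : Fin 4 → ℝ}
    (hs : |s| ≤ 1) (hd : Real.sqrt d ≤ B) (hlam : 0 ≤ lam) (hρ : 0 ≤ ρ) (hb : |b| ≤ 1)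
    (hB : lam * (n + ρ) + 2 ≤ B) (hg : ∑ i, g i ^ 2 ≤ 1) :
    (selfGate (d := d) src dst s lam ρ b g).Bounded n B := by
  refine ⟨?_, ?_, hg⟩
  · rw [selfGate, frob_smul, frob_one]
    have := Real.sqrt_nonneg (d : ℝ)
    nlinarith
  · simp only [selfGate]
    have h1 : |b - lam * ρ| ≤ 1 + lam * ρ := by
      refine (abs_sub _ _).trans ?_
      rw [abs_of_nonneg (mul_nonneg hlam hρ)]
      linarith
    rw [abs_of_nonneg hlam]
    linarith

lemma kernelGate_bounded {S : Matrix (Fin d) (Fin d) ℝ} {s lam b n B : ℝ}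
    (hs : |s| * frob S ≤ B) (hB : |lam| * n + |b| + 1 ≤ B) :
    (kernelGate S s lam b).Bounded n B :=
  ⟨(frob_smul s S).le.trans hs, hB, by simp [kernelGate]⟩

lemma descentBlocks_bounded {Q : Matrix (Fin de) (Fin de) ℝ} {S : Matrix (Fin d) (Fin d) ℝ}
    {v w : ℕ → ℝ} {J K : ℕ} {lam ρ n B q : ℝ} (hn : 0 ≤ n) (hQ : ∑ a, ∑ b, Q a b ^ 2 ≤ n ^ 2)
    (hlam : 0 ≤ lam) (hρ : 0 ≤ ρ) (hv : ∀ k ≤ J, |v k| ≤ ρ) (hw : |w J| ≤ 1)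
    (hslope : ∀ k < J, |(w k - w (k + 1)) / (v k - v (k + 1))| ≤ q)
    (hB₁ : Real.sqrt d ≤ B) (hB₂ : q * frob S ≤ B) (hB₃ : frob S ≤ B)
    (hB₄ : lam * (n + ρ) + 2 ≤ B) (hB₅ : n + ρ + 1 ≤ B) :
    ∀ b ∈ descentBlocks Q S v w J lam ρ K, b.Bounded 4 B := by
  have hS : 0 ≤ frob S := Real.sqrt_nonneg _
  have h2 : 2 ≤ B := by nlinarith
  have hself : ∀ (src : Option (Fin 5)) (dst : Fin 5) (s b : ℝ) (g : Fin 4 → ℝ), |s| ≤ 1 →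
      |b| ≤ 1 → ∑ i, g i ^ 2 ≤ 1 → (selfGate (d := d) src dst s lam ρ b g).Bounded n B :=
    fun src dst s b g hs hb hg => selfGate_bounded src dst hs hB₁ hlam hρ hb hB₄ hg
  have hsingle : ∀ k : Fin 4, ∑ i, (Pi.single k 1 : Fin 4 → ℝ) i ^ 2 ≤ 1 := fun k => by
    simp [Pi.single_apply]
  have hzero : ∑ i, (0 : Fin 4 → ℝ) i ^ 2 ≤ 1 := by simp
  have hblock : ∀ l : List (Gate d), l.length ≤ 4 → (∀ a ∈ l, a.Bounded n B) →
      (gateBlock Q l).Bounded 4 B :=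
    fun l hl h => gateBlock_bounded hn hQ (by linarith) hl h
  intro b hb
  rw [descentBlocks, List.mem_cons] at hb
  rcases hb with rfl | hb
  · refine hblock _ (by simp) ?_
    simp only [List.mem_cons, List.not_mem_nil, or_false, forall_eq_or_imp, forall_eq]
    exact ⟨hself _ _ _ _ _ (by simp) (by simp) hzero,
      hself _ _ _ _ _ (by simp) (by simp) (hsingle _)⟩
  · obtain ⟨l, hl, hbl⟩ := List.mem_flatten.1 hb
    rw [List.eq_of_mem_replicate hl, stepBlocks, List.mem_append] at hbl
    rcases hbl with hbl | hbl
    · obtain ⟨k, hk, rfl⟩ := List.mem_map.1 hbl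
      rw [List.mem_range] at hk
      have hker : ∀ (s : ℝ) (m : ℕ), |s| ≤ q → m ≤ J → (kernelGate S s 1 (-v m)).Bounded n B := by
        intro s m hs hm
        refine kernelGate_bounded ((mul_le_mul_of_nonneg_right hs hS).trans hB₂) ?_
        rw [abs_neg, abs_one, one_mul]
        linarith [hv m hm]
      refine hblock _ (by simp) ?_
      simp only [List.mem_cons, List.not_mem_nil, or_false, forall_eq_or_imp, forall_eq]
      exact ⟨hker _ _ (hslope k hk) (by omega),
        hker _ _ (by rw [abs_neg]; exact hslope k hk) (by omega)⟩
    · simp only [List.mem_cons, List.not_mem_nil, or_false] at hbl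
      rcases hbl with rfl | rfl | rfl
      · refine hblock _ (by simp) ?_
        simp only [List.mem_cons, List.not_mem_nil, or_false, forall_eq]
        refine kernelGate_bounded ?_ (by simp; linarith)
        nlinarith
      · refine hblock _ (by simp) ?_
        simp only [List.mem_cons, List.not_mem_nil, or_false, forall_eq_or_imp, forall_eq]
        exact ⟨hself _ _ _ _ _ (by simp) (by simp) (hsingle _),
          hself _ _ _ _ _ (by simp) (by simp) (hsingle _),
          hself _ _ _ _ _ (by simp) (by simp) hzero, hself _ _ _ _ _ (by simp) (by simp) hzero⟩
      · refine hblock _ (by simp) ?_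
        simp only [List.mem_cons, List.not_mem_nil, or_false, forall_eq_or_imp, forall_eq]
        exact ⟨hself _ _ _ _ _ (by rw [abs_le]; norm_num) (by simp) (hsingle _),
          hself _ _ _ _ _ (by simp) (by simp) hzero⟩

lemma Block.Bounded.mono {κ : Type} [Fintype κ] {b : Block κ} {M M' : ℕ} {B B' : ℝ}
    (h : b.Bounded M B) (hM : M ≤ M') (hB : B ≤ B') : b.Bounded M' B' :=
  ⟨h.heads_le.trans hM, fun a ha => ⟨(h.head_le a ha).1.trans hB, (h.head_le a ha).2.1.trans hB,
    (h.head_le a ha).2.2.trans hB⟩, ⟨h.weight_le.1.trans hB, h.weight_le.2.trans hB⟩,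
    ⟨h.offset_le.1.trans hB, h.offset_le.2.trans hB⟩⟩

/-- The constant in the bound of the weights. -/
def weightConst (c Cμ : ℝ) : ℝ :=
  |Cμ| * (4 / c ^ 2) + 2 / c ^ 2 * (8 / c ^ 2 + 1) + 20 / c ^ 2 + 2

lemma weightConst_nonneg {c Cμ : ℝ} : 0 ≤ weightConst c Cμ := by
  unfold weightConst; positivity

/-- All quantities that occur in the weights are of the order `Λ σ⁻² n d (r² + ‖Σ‖)`. The radius of
the time embeddings is at least `c / 2`, because two of them have distance at least `c`; this is
what lets `r²` absorb constants. -/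
lemma weight_bounds {c Cμ Λ τ n d r F s : ℝ} (hc : 0 < c) (hΛ : 1 / 2 ≤ Λ) (hτ : 1 ≤ τ)
    (hn : 2 ≤ n) (hd : 1 ≤ d) (hr : c / 2 ≤ r) (hs : 0 ≤ s) (hF0 : 0 ≤ F) (hF : F ≤ d * s)
    {B : ℝ} (hB : B = weightConst c Cμ * (Λ * τ * (n * d) * (r ^ 2 + s))) :
    Real.sqrt d ≤ B ∧ 2 / c ^ 2 * F ≤ B ∧ F ≤ B ∧
      2 * τ / c ^ 2 * (Real.sqrt n + r ^ 2) + 2 ≤ B ∧ Real.sqrt n + r ^ 2 + 1 ≤ B ∧ Cμ * d ≤ B := by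
  set X := Λ * τ * (n * d) * (r ^ 2 + s) with hX
  have hr0 : 0 < r := by linarith
  have hr2 : c ^ 2 / 4 ≤ r ^ 2 := by nlinarith
  have hΛn : 1 ≤ Λ * n := by nlinarith
  have hsn : Real.sqrt n ≤ n := Real.sqrt_le_iff.2 ⟨by linarith, by nlinarith⟩
  have hsd : Real.sqrt d ≤ d := Real.sqrt_le_iff.2 ⟨by linarith, by nlinarith⟩
  have hXr : Λ * n * (τ * d * (r ^ 2 + s)) = X := by rw [hX]; ring
  have hτd : 1 ≤ τ * d := by nlinarith
  have hX1 : τ * d * (r ^ 2 + s) ≤ X := by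
    rw [← hXr]
    exact le_mul_of_one_le_left (by positivity) hΛn
  have hXr2 : τ * d * r ^ 2 ≤ X := le_trans (by gcongr; linarith) hX1
  have hXs : τ * d * s ≤ X := le_trans (by gcongr; nlinarith) hX1
  have hr2X : τ * r ^ 2 ≤ X := le_trans (by
    have : τ * r ^ 2 * 1 ≤ τ * r ^ 2 * d := by gcongr
    linarith) hXr2
  have hdX : d ≤ 4 / c ^ 2 * X := by
    have h1 : d * (c ^ 2 / 4) ≤ X := by
      calc d * (c ^ 2 / 4) ≤ d * r ^ 2 := by gcongr
        _ ≤ τ * (d * r ^ 2) := le_mul_of_one_le_left (by positivity) hτ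
        _ ≤ X := by linarith
    calc d = 4 / c ^ 2 * (d * (c ^ 2 / 4)) := by field_simp
      _ ≤ _ := by gcongr
  have hFX : F ≤ X := by
    calc F ≤ d * s := hF
      _ ≤ τ * (d * s) := le_mul_of_one_le_left (by positivity) hτ
      _ ≤ X := by linarith
  have hnX : τ * n ≤ 8 / c ^ 2 * X := by
    have h1 : τ * n * (c ^ 2 / 8) ≤ X := by
      have h2 : 1 / 2 * (τ * n * (c ^ 2 / 4)) ≤ Λ * (τ * n * (d * (r ^ 2 + s))) := by
        gcongr
        nlinarith
      calc τ * n * (c ^ 2 / 8) = 1 / 2 * (τ * n * (c ^ 2 / 4)) := by ring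
        _ ≤ _ := h2
        _ = X := by rw [hX]; ring
    calc τ * n = 8 / c ^ 2 * (τ * n * (c ^ 2 / 8)) := by field_simp
      _ ≤ _ := by gcongr
  have hX0 : 0 ≤ X := hF0.trans hFX
  have h1X : 1 ≤ 4 / c ^ 2 * X := hd.trans hdX
  have hnX' : n ≤ 8 / c ^ 2 * X := le_trans (le_mul_of_one_le_left (by linarith) hτ) hnX
  have hrX' : r ^ 2 ≤ X := le_trans (le_mul_of_one_le_left (by positivity) hτ) hr2X
  have ha : 0 ≤ |Cμ| * (4 / c ^ 2) := by positivity
  have hb : 0 ≤ 2 / c ^ 2 * (8 / c ^ 2 + 1) := by positivity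
  have hq : 0 < 1 / c ^ 2 := by positivity
  have e4 : 4 / c ^ 2 = 4 * (1 / c ^ 2) := by ring
  have e8 : 8 / c ^ 2 = 8 * (1 / c ^ 2) := by ring
  have e2 : 2 / c ^ 2 = 2 * (1 / c ^ 2) := by ring
  have e20 : 20 / c ^ 2 = 20 * (1 / c ^ 2) := by ring
  have hBX : B = |Cμ| * (4 / c ^ 2) * X + 2 / c ^ 2 * (8 / c ^ 2 + 1) * X + 20 / c ^ 2 * X +
      2 * X := by
    rw [hB, weightConst]; ring
  have t1 : 0 ≤ |Cμ| * (4 / c ^ 2) * X := by positivity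
  have t2 : 0 ≤ 2 / c ^ 2 * (8 / c ^ 2 + 1) * X := by positivity
  have t3 : 0 ≤ 1 / c ^ 2 * X := by positivity
  have f4 : 4 / c ^ 2 * X = 4 * (1 / c ^ 2 * X) := by ring
  have f8 : 8 / c ^ 2 * X = 8 * (1 / c ^ 2 * X) := by ring
  have f20 : 20 / c ^ 2 * X = 20 * (1 / c ^ 2 * X) := by ring
  refine ⟨?_, ?_, ?_, ?_, ?_, ?_⟩
  · linarith
  · have : 2 / c ^ 2 * F ≤ 2 / c ^ 2 * X := by gcongr
    have f2 : 2 / c ^ 2 * X = 2 * (1 / c ^ 2 * X) := by ring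
    linarith
  · linarith
  · have h1 : 2 * τ / c ^ 2 * (Real.sqrt n + r ^ 2) ≤ 2 / c ^ 2 * (8 / c ^ 2 + 1) * X := by
      calc 2 * τ / c ^ 2 * (Real.sqrt n + r ^ 2)
          = 2 / c ^ 2 * (τ * Real.sqrt n + τ * r ^ 2) := by ring
        _ ≤ 2 / c ^ 2 * (τ * n + τ * r ^ 2) := by gcongr
        _ ≤ 2 / c ^ 2 * (8 / c ^ 2 * X + X) := by gcongr
        _ = _ := by ring
    linarith
  · linarith
  · have h1 : Cμ * d ≤ |Cμ| * (4 / c ^ 2) * X := by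
      calc Cμ * d ≤ |Cμ| * d := by gcongr; exact le_abs_self _
        _ ≤ |Cμ| * (4 / c ^ 2 * X) := by gcongr
        _ = _ := by ring
    linarith

end Bounds

/-! ### Truncation error, total error and depth -/

section Truncation

/-- The covariance at time lag `J` is at most `exp (-J)`, because `ℓ ≤ c ^ ν`. -/
lemma exp_neg_rpow_div_le {c ν ℓ y : ℝ} {J : ℕ} (hc : 0 < c) (hν : 1 ≤ ν) (hℓ : 0 < ℓ)
    (hℓc : ℓ ≤ c ^ ν) (hJ : 1 ≤ J) (hy : c * J ≤ y) :
    Real.exp (-(y ^ ν / ℓ)) ≤ Real.exp (-(J : ℝ)) := by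
  have hJ' : (1 : ℝ) ≤ J := by exact_mod_cast hJ
  refine Real.exp_le_exp.2 (neg_le_neg ?_)
  rw [le_div_iff₀ hℓ]
  calc (J : ℝ) * ℓ ≤ (J : ℝ) ^ ν * c ^ ν := by
        gcongr
        calc (J : ℝ) = (J : ℝ) ^ (1 : ℝ) := (Real.rpow_one _).symm
          _ ≤ _ := Real.rpow_le_rpow_of_exponent_le hJ' hν
    _ = (c * J) ^ ν := by rw [mul_comm, Real.mul_rpow hc.le (by positivity)]
    _ ≤ y ^ ν := Real.rpow_le_rpow (by positivity) hy (by linarith)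

end Truncation

section Numerics

lemma half_le_log_two : (1 : ℝ) / 2 ≤ Real.log 2 := by
  have := Real.log_two_gt_d9
  linarith

lemma two_pow_le_exp {Λ : ℝ} (hΛ : Real.log 2 ≤ Λ) (k : ℕ) : (2 : ℝ) ^ k ≤ Real.exp (k * Λ) := by
  rw [Real.exp_nat_mul]
  gcongr
  rw [← Real.exp_log (show (0 : ℝ) < 2 by norm_num)]
  exact Real.exp_le_exp.2 hΛ

/-- The two contributions to the mean squared error: that of the descent, of relative accuracy
`4 exp (-5 Λ)`, and the Gaussian tail beyond the clipping radius. -/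
lemma error_le {Λ n ε : ℝ} (hΛ : Real.log 2 ≤ Λ) (hn : 1 ≤ n) (hε : 0 < ε)
    (h : n / ε ≤ Real.exp Λ) :
    (4 * Real.exp (-(5 * Λ))) ^ 2 * (8 * n) +
      72 * Real.exp (-(32 * Λ ^ 2 * n)) * Real.exp (n / 2) ≤ ε := by
  have hΛ2 := half_le_log_two.trans hΛ
  have h1 : n ≤ ε * Real.exp Λ := by rwa [div_le_iff₀' hε] at h
  have hcancel : ∀ k : ℕ, Real.exp (-(k * Λ)) ≤ (2 ^ k)⁻¹ := fun k => by
    rw [Real.exp_neg]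
    exact inv_anti₀ (by positivity) (two_pow_le_exp hΛ k)
  have e9 := hcancel 9
  have e14 := hcancel 14
  have t1 : (4 * Real.exp (-(5 * Λ))) ^ 2 * (8 * n) ≤ ε / 2 := by
    have h2 : Real.exp (-(5 * Λ)) ^ 2 * Real.exp Λ = Real.exp (-((9 : ℕ) * Λ)) := by
      rw [← Real.exp_nat_mul, ← Real.exp_add]; congr 1; push_cast; ring
    calc (4 * Real.exp (-(5 * Λ))) ^ 2 * (8 * n)
        = 128 * Real.exp (-(5 * Λ)) ^ 2 * n := by ring
      _ ≤ 128 * Real.exp (-(5 * Λ)) ^ 2 * (ε * Real.exp Λ) := by gcongr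
      _ = 128 * ε * (Real.exp (-(5 * Λ)) ^ 2 * Real.exp Λ) := by ring
      _ ≤ 128 * ε * (2 ^ 9)⁻¹ := by rw [h2]; gcongr
      _ ≤ _ := by norm_num; linarith
  have t2 : 72 * Real.exp (-(32 * Λ ^ 2 * n)) * Real.exp (n / 2) ≤ ε / 2 := by
    have h3 : Real.exp (-(32 * Λ ^ 2 * n)) * Real.exp (n / 2) ≤
        Real.exp (-((14 : ℕ) * Λ)) * Real.exp (-Λ) := by
      rw [← Real.exp_add, ← Real.exp_add]
      refine Real.exp_le_exp.2 ?_
      push_cast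
      have h4 : Λ * n ≤ 2 * (Λ ^ 2 * n) := by
        nlinarith [mul_nonneg (by linarith : (0 : ℝ) ≤ Λ) (by linarith : (0 : ℝ) ≤ n)]
      nlinarith
    have h5 : Real.exp (-Λ) ≤ ε := by
      rw [Real.exp_neg, inv_le_iff_one_le_mul₀ (Real.exp_pos _)]
      linarith
    calc 72 * Real.exp (-(32 * Λ ^ 2 * n)) * Real.exp (n / 2)
        = 72 * (Real.exp (-(32 * Λ ^ 2 * n)) * Real.exp (n / 2)) := by ring
      _ ≤ 72 * (Real.exp (-((14 : ℕ) * Λ)) * Real.exp (-Λ)) := by gcongr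
      _ ≤ 72 * ((2 ^ 14)⁻¹ * ε) := by gcongr
      _ ≤ _ := by norm_num; linarith
  linarith

/-- The depth of the network: `K` steps of `J + 3` layers. -/
lemma depth_le {Λ κ : ℝ} (hΛ : 1 / 2 ≤ Λ) (hκ : 1 ≤ κ) {L₀ K J : ℕ} (hK : K ≤ 80 * κ * Λ + 1)
    (hJ : J ≤ 6 * Λ + 1) :
    ((L₀ + (K * (J + 3) + 1) : ℕ) : ℝ) ≤ (4 * L₀ + 1200) * (κ * Λ ^ 2) := by
  push_cast
  have h1 : 1 / 2 ≤ κ * Λ := by nlinarith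
  have hK' : (K : ℝ) ≤ 82 * (κ * Λ) := by linarith
  have hJ' : (J : ℝ) + 3 ≤ 14 * Λ := by linarith
  have h2 : (K : ℝ) * (J + 3) ≤ 82 * (κ * Λ) * (14 * Λ) := by gcongr
  have h3 : 1 ≤ 4 * (κ * Λ ^ 2) := by nlinarith
  have h4 : (L₀ : ℝ) * 1 ≤ L₀ * (4 * (κ * Λ ^ 2)) := by gcongr
  nlinarith

end Numerics

/-! ### The mean squared error of the network -/

section Assembly

variable {N d de : ℕ}

lemma continuous_descent {E F : Type*} [NormedAddCommGroup E] [InnerProductSpace ℝ E]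
    [TopologicalSpace F] (B : E →L[ℝ] E) (η : ℝ) {z : F → E} (hz : Continuous z) (k : ℕ) :
    Continuous fun x => descent (B : E →ₗ[ℝ] E) η (z x) k := by
  induction k with
  | zero => exact continuous_const
  | succ k ih =>
    simp only [descent, ContinuousLinearMap.coe_coe]
    fun_prop

/-- By time lag, the inner products `v` of the time embeddings and the values `w` of the temporal
covariance: these are the knots and values of an interpolation with bounded slopes, and truncating
the lag at `J₀` costs at most `exp (-J₀)` in every entry. -/
lemma DecayAssumption.exists_lag {H : ℝ} {e : Fin N → EuclideanSpace ℝ (Fin de)} {r c ν ℓ : ℝ}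
    {γ : Set.Icc (0 : ℝ) H → Set.Icc (0 : ℝ) H → ℝ} {h : Fin N → Set.Icc (0 : ℝ) H}
    (hD : DecayAssumption e r c ν ℓ γ h) (hc : 0 < c) (hN : 2 ≤ N) (hℓ : ℓ ≤ c ^ ν) :
    c / 2 ≤ r ∧ (∀ i j, i ≠ j → c ≤ ‖e i - e j‖) ∧
    ∃ v w : ℕ → ℝ, (∀ i j : Fin N, inner ℝ (e i) (e j) = v (Nat.dist i j)) ∧
      StrictAntiOn v (Set.Iio N) ∧ (∀ k < N, |v k| ≤ r ^ 2) ∧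
      (∀ i j, temporalMatrix γ h i j = w (Nat.dist i j)) ∧ w 0 = 1 ∧ (∀ k < N, |w k| ≤ 1) ∧
      (∀ k, k + 1 < N → |(w k - w (k + 1)) / (v k - v (k + 1))| ≤ 2 / c ^ 2) ∧
      ∀ J₀ : ℕ, 1 ≤ J₀ → ∀ i j, |truncatedMatrix N w (min J₀ (N - 1)) i j -
        temporalMatrix γ h i j| ≤ Real.exp (-(J₀ : ℝ)) := by
  obtain ⟨f, hmono, -, hcf, hdist⟩ := hD.dist_eq
  obtain ⟨hν1, hν2⟩ := hD.exponent
  have hℓ0 := hD.bandwidth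
  have hf0 : f 0 = 0 := by
    have := hdist ⟨0, by omega⟩ ⟨0, by omega⟩
    simpa using this.symm
  have hfnn : ∀ k < N, 0 ≤ f k := fun k hk => by
    have := hcf k hk
    have : (0 : ℝ) ≤ c * k := by positivity
    linarith
  have hlt : ∀ i j : Fin N, Nat.dist i j < N := fun i j => by
    have := i.isLt; have := j.isLt
    simp only [Nat.dist]; omega
  have hsep : ∀ i j, i ≠ j → c ≤ ‖e i - e j‖ := by
    intro i j hij
    rw [hdist]
    have h1 : 1 ≤ Nat.dist i j := by
      have : (i : ℕ) ≠ j := fun h => hij (Fin.ext h)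
      simp only [Nat.dist]; omega
    have h2 := hcf _ (hlt i j)
    have h3 : (1 : ℝ) ≤ Nat.dist i j := by exact_mod_cast h1
    nlinarith
  have hr : c / 2 ≤ r := by
    have h1 := hsep ⟨0, by omega⟩ ⟨1, by omega⟩ (by simp)
    have h2 := norm_sub_le (e ⟨0, by omega⟩) (e ⟨1, by omega⟩)
    rw [hD.norm_eq, hD.norm_eq] at h2
    linarith
  have hinner : ∀ i j : Fin N, inner ℝ (e i) (e j) = r ^ 2 - f (Nat.dist i j) ^ 2 / 2 := by
    intro i j
    rw [inner_eq_of_norm_eq (hD.norm_eq i) (hD.norm_eq j), hdist]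
  have hΓ : ∀ i j, temporalMatrix γ h i j = Real.exp (-(f (Nat.dist i j) ^ ν / ℓ)) := by
    intro i j
    rw [temporalMatrix, Matrix.of_apply, hD.decay, hdist]
  have hanti : ∀ k m, k ≤ m → m < N →
      Real.exp (-(f m ^ ν / ℓ)) ≤ Real.exp (-(f k ^ ν / ℓ)) := by
    intro k m hkm hm
    refine Real.exp_le_exp.2 (neg_le_neg ?_)
    have h1 := hmono.monotoneOn (Set.mem_Iio.2 (by omega)) (Set.mem_Iio.2 hm) hkm
    have h2 := hfnn k (by omega)
    gcongr
  refine ⟨hr, hsep, fun k => r ^ 2 - f k ^ 2 / 2, fun k => Real.exp (-(f k ^ ν / ℓ)), hinner,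
    ?_, ?_, hΓ, ?_, ?_, ?_, ?_⟩
  · intro a ha b hb hab
    have h1 := hmono ha hb hab
    have h2 := hfnn a ha
    change r ^ 2 - f b ^ 2 / 2 < r ^ 2 - f a ^ 2 / 2
    nlinarith
  · intro k hk
    have h1 := hinner ⟨0, by omega⟩ ⟨k, hk⟩
    have h2 : Nat.dist 0 k = k := by simp [Nat.dist]
    simp only [h2] at h1
    change |r ^ 2 - f k ^ 2 / 2| ≤ r ^ 2
    rw [← h1]
    refine (abs_real_inner_le_norm _ _).trans ?_
    rw [hD.norm_eq, hD.norm_eq, sq]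
  · change Real.exp (-(f 0 ^ ν / ℓ)) = 1
    rw [hf0, Real.zero_rpow (by linarith)]
    simp
  · intro k hk
    change |Real.exp (-(f k ^ ν / ℓ))| ≤ 1
    rw [abs_of_pos (Real.exp_pos _), Real.exp_le_one_iff, neg_nonpos]
    have := hfnn k hk
    positivity
  · intro k hk
    have h1 := hmono (Set.mem_Iio.2 (by omega : k < N)) (Set.mem_Iio.2 hk) (Nat.lt_succ_self k)
    have h2 : c ≤ f (k + 1) := by
      have h3 := hcf _ hk
      push_cast at h3
      nlinarith [mul_nonneg hc.le (Nat.cast_nonneg (α := ℝ) k)]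
    have h4 : f k = 0 ∨ c ≤ f k := by
      rcases Nat.eq_zero_or_pos k with rfl | hk0
      · exact Or.inl hf0
      · right
        have h3 := hcf k (by omega)
        have h5 : (1 : ℝ) ≤ k := by exact_mod_cast hk0
        nlinarith
    have h6 := slope_le hc hν1 hν2 hℓ0 h4 h2 h1
    convert h6 using 3
    ring
  · intro J₀ hJ₀ i j
    have hm := hlt i j
    rw [hΓ, truncatedMatrix, Matrix.of_apply]
    generalize Nat.dist (i : ℕ) j = m at hm ⊢
    rcases le_total m (min J₀ (N - 1)) with hle | hle
    · rw [min_eq_left hle, sub_self, abs_zero]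
      positivity
    · rw [min_eq_right hle]
      rcases le_total J₀ (N - 1) with hJN | hJN
      · rw [min_eq_left hJN] at hle ⊢
        have h1 := hanti J₀ m hle hm
        have h2 := Real.exp_pos (-(f m ^ ν / ℓ))
        have h3 := exp_neg_rpow_div_le hc hν1 hℓ0 hℓ hJ₀ (hcf J₀ (by omega))
        rw [abs_of_nonneg (by linarith)]
        linarith
      · rw [min_eq_right hJN] at hle ⊢
        rw [show m = N - 1 by omega, sub_self, abs_zero]
        positivity

lemma stepSize_nonneg_le [Nonempty (Fin N × Fin d)] {Γ : Matrix (Fin N) (Fin N) ℝ}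
    {S : Matrix (Fin d) (Fin d) ℝ} (hG : (Γ ⊗ₖ S).PosSemidef) {t : ℝ} (ht : 0 < t) :
    0 ≤ stepSize Γ S t ∧ stepSize Γ S t ≤ (sigma t ^ 2)⁻¹ := by
  have h0 := pow_pos (sigma_pos ht) 2
  have h1 := sigma_sq_le_eigMin hG t
  have h2 : eigMin (diffusedCov Γ S t) ≤ eigMax (diffusedCov Γ S t) :=
    eigMin_le_eigMax (isHermitian_smul_add hG.1 _ _)
  rw [stepSize]
  refine ⟨div_nonneg zero_le_two (by linarith), ?_⟩
  rw [div_le_iff₀ (by linarith), ← div_eq_inv_mul, le_div_iff₀ h0]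
  linarith

lemma sigma_sq_lt_one {t : ℝ} (ht : 0 < t) : sigma t ^ 2 < 1 := by
  rw [sigma_sq ht.le]
  linarith [Real.exp_pos (-t)]

lemma sigma_sq_mono {t₀ t : ℝ} (h0 : 0 ≤ t₀) (ht : t₀ ≤ t) : sigma t₀ ^ 2 ≤ sigma t ^ 2 := by
  rw [sigma_sq h0, sigma_sq (h0.trans ht)]
  have : Real.exp (-t) ≤ Real.exp (-t₀) := Real.exp_le_exp.2 (by linarith)
  linarith

/-- The time features are nonnegative and at most `σ₀⁻²`. -/
lemma timeFeature_bounds [Nonempty (Fin N × Fin d)] {Γ : Matrix (Fin N) (Fin N) ℝ}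
    {S : Matrix (Fin d) (Fin d) ℝ} (hG : (Γ ⊗ₖ S).PosSemidef) {t₀ t : ℝ} (h0 : 0 < t₀)
    (ht : t₀ ≤ t) (k : Fin 4) :
    0 ≤ timeFeature Γ S t k ∧ timeFeature Γ S t k ≤ (sigma t₀ ^ 2)⁻¹ := by
  have ht0 : 0 < t := h0.trans_le ht
  have hσ0 := pow_pos (sigma_pos h0) 2
  have h1 : 1 ≤ (sigma t₀ ^ 2)⁻¹ := (one_le_inv₀ hσ0).2 (sigma_sq_lt_one h0).le
  have ha : alpha t ≤ 1 := Real.exp_le_one_iff.2 (by linarith)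
  have ha0 := alpha_pos t
  obtain ⟨h2, h3⟩ := stepSize_nonneg_le hG ht0
  have h4 : (sigma t ^ 2)⁻¹ ≤ (sigma t₀ ^ 2)⁻¹ := inv_anti₀ hσ0 (sigma_sq_mono h0.le ht)
  have h5 := sigma_sq_lt_one ht0
  fin_cases k
  · exact ⟨h2, h3.trans h4⟩
  · exact ⟨ha0.le, ha.trans h1⟩
  · exact ⟨sq_nonneg (sigma t), h5.le.trans h1⟩
  · exact ⟨sq_nonneg (alpha t), (pow_le_one₀ ha0.le ha).trans h1⟩

/-- The mean squared error of clipped gradient descent with a perturbed temporal covariance. The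
constants in the bounds for `J₀` and `K` make the relative errors of the covariance and of the
descent at most `exp (-5 Λ)` each. -/
lemma integral_clip_descent_le (hN : 1 ≤ N) (hd : 1 ≤ d)
    {Γ Γ' : Matrix (Fin N) (Fin N) ℝ} {S : Matrix (Fin d) (Fin d) ℝ}
    (hG : (Γ ⊗ₖ S).PosSemidef) (hS : S.PosSemidef) (hΓ' : Γ'.IsHermitian) {ε : ℝ} (hε : 0 < ε)
    (hΓ : ∀ x, ε * (x ⬝ᵥ x) ≤ x ⬝ᵥ Γ *ᵥ x) {Λ : ℝ} (hΛ : Real.log 2 ≤ Λ)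
    (hΛn : (N * d : ℝ) / ε ≤ Real.exp Λ) {J₀ : ℕ} (hJ₀ : 6 * Λ ≤ J₀)
    (hδ : ∀ i j, |Γ' i j - Γ i j| ≤ Real.exp (-(J₀ : ℝ))) {t₀ t : ℝ} (h0 : 0 < t₀) (ht : t₀ ≤ t)
    {K : ℕ} (hK : 80 * condNumber (diffusedCov Γ S t₀) * Λ ≤ K)
    (m : EuclideanSpace ℝ (Fin N × Fin d)) {s : EuclideanSpace ℝ (Fin N × Fin d) →
      EuclideanSpace ℝ (Fin N × Fin d)}
    (hs : ∀ x, s x = clip (32 * (Λ * Real.sqrt (N * d) / sigma t))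
      (descent (Matrix.toEuclideanCLM (𝕜 := ℝ) (diffusedCov Γ' S t) :
          EuclideanSpace ℝ (Fin N × Fin d) →ₗ[ℝ] EuclideanSpace ℝ (Fin N × Fin d))
        (stepSize Γ S t / 4) (x - alpha t • m) K)) :
    Integrable (fun x => ‖s x - score (multivariateGaussian m (Γ ⊗ₖ S)) t x‖ ^ 2 *
      diffusedDensity (multivariateGaussian m (Γ ⊗ₖ S)) t x) ∧
    ∫ x, ‖s x - score (multivariateGaussian m (Γ ⊗ₖ S)) t x‖ ^ 2 *
      diffusedDensity (multivariateGaussian m (Γ ⊗ₖ S)) t x ≤ ε / sigma t ^ 2 := by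
  have : Nonempty (Fin N × Fin d) := ⟨⟨0, by omega⟩, ⟨0, by omega⟩⟩
  have ht0 : 0 < t := h0.trans_le ht
  have hσ := sigma_pos ht0
  have hΛ2 := half_le_log_two.trans hΛ
  have hN' : (1 : ℝ) ≤ N := by exact_mod_cast hN
  have hd' : (1 : ℝ) ≤ d := by exact_mod_cast hd
  have hn : (1 : ℝ) ≤ N * d := by nlinarith
  have hexp5 : Real.exp (-(5 * Λ)) ≤ 1 / 32 := by
    have := two_pow_le_exp hΛ 5
    push_cast at this
    rw [Real.exp_neg, inv_le_comm₀ (Real.exp_pos _) (by norm_num)]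
    norm_num at this ⊢
    exact this
  have hτ : N * Real.exp (-(J₀ : ℝ)) / ε ≤ Real.exp (-(5 * Λ)) := by
    calc N * Real.exp (-(J₀ : ℝ)) / ε ≤ N * d * Real.exp (-(6 * Λ)) / ε := by
          gcongr
          nlinarith
      _ = N * d / ε * Real.exp (-(6 * Λ)) := by ring
      _ ≤ Real.exp Λ * Real.exp (-(6 * Λ)) := by gcongr
      _ = _ := by rw [← Real.exp_add]; congr 1; ring
  have hKt : Real.exp (-(K / (16 * condNumber (diffusedCov Γ S t)))) ≤ Real.exp (-(5 * Λ)) := by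
    refine Real.exp_le_exp.2 (neg_le_neg ?_)
    have h1 := one_le_condNumber hG ht0
    have h2 := condNumber_antitone hG h0 ht
    rw [le_div_iff₀ (by linarith)]
    have h3 : 80 * condNumber (diffusedCov Γ S t) * Λ ≤
        80 * condNumber (diffusedCov Γ S t₀) * Λ := by gcongr
    linarith
  have hdesc := fun y => norm_descent_score_le hG hS hΓ' hε hΓ (Real.exp_pos _).le hδ
    (hτ.trans (hexp5.trans (by norm_num))) ht0 y K
  set D : EuclideanSpace ℝ (Fin N × Fin d) → EuclideanSpace ℝ (Fin N × Fin d) := fun x =>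
    descent (Matrix.toEuclideanCLM (𝕜 := ℝ) (diffusedCov Γ' S t) :
          EuclideanSpace ℝ (Fin N × Fin d) →ₗ[ℝ] EuclideanSpace ℝ (Fin N × Fin d))
        (stepSize Γ S t / 4) (x - alpha t • m) K with hDdef
  have hDm : Measurable D :=
    (continuous_descent _ _ (by fun_prop) K).measurable
  have hR : 0 ≤ 32 * (Λ * Real.sqrt (N * d) / sigma t) := by positivity
  have hmain := integral_clip_sub_score_le m hG ht0 hDm hR
    (κ := 4 * Real.exp (-(5 * Λ))) (by linarith) (fun y => by
      rw [hDdef]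
      simp only [add_sub_cancel_left]
      refine (hdesc y).trans (mul_le_mul_of_nonneg_right (by linarith) (Real.sqrt_nonneg _)))
  have hsD : s = fun x => clip (32 * (Λ * Real.sqrt (N * d) / sigma t)) (D x) := funext hs
  rw [hsD]
  refine ⟨hmain.1, hmain.2.trans ?_⟩
  gcongr
  have hRs : (32 * (Λ * Real.sqrt (N * d) / sigma t)) ^ 2 * sigma t ^ 2 / 32 =
      32 * Λ ^ 2 * (N * d) := by
    have := Real.sq_sqrt (by positivity : (0 : ℝ) ≤ N * d)
    field_simp
    rw [this]
  have hcard : (Fintype.card (Fin N × Fin d) : ℝ) = N * d := by simp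
  rw [hRs, hcard]
  exact error_le hΛ hn hε hΛn

end Assembly

end ScoreTransformer

end

open ScoreTransformer

theorem theorem1 (c : ℝ) (hc : 0 < c) (Lμ Mμ : ℕ) (Cμ : ℝ) :
    ∃ C : ℝ, 0 < C ∧
    ∀ (N d de : ℕ) (_ : 2 ≤ N) (_ : 1 ≤ d)
      {Ω : Type*} [MeasurableSpace Ω] (P : Measure Ω) (H : ℝ)
      (X : Set.Icc (0 : ℝ) H → Ω → EuclideanSpace ℝ (Fin d))
      (m : Set.Icc (0 : ℝ) H → EuclideanSpace ℝ (Fin d))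
      (γ : Set.Icc (0 : ℝ) H → Set.Icc (0 : ℝ) H → ℝ)
      (S : Matrix (Fin d) (Fin d) ℝ)
      (_ : ScoreTransformer.IsGPData P X m γ S)
      (h : Fin N → Set.Icc (0 : ℝ) H) (_ : ScoreTransformer.IsUniformGrid h)
      (e : Fin N → EuclideanSpace ℝ (Fin de)) (r ν ℓ : ℝ)
      (_ : ScoreTransformer.DecayAssumption e r c ν ℓ γ h) (_ : ℓ ≤ c ^ ν)
      (t₀ T : ℝ) (_ : 0 < t₀) (_ : t₀ ≤ T)
      (Γ : Matrix (Fin N) (Fin N) ℝ) (_ : Γ = ScoreTransformer.temporalMatrix γ h)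
      (φ : ℝ → Fin 4 → ℝ) (_ : φ = ScoreTransformer.timeFeature Γ S)
      (_ : ScoreTransformer.MeanRepresentable e φ (fun i => m (h i)) (Set.Icc t₀ T)
        Lμ Mμ (Cμ * d))
      (P₀ : Measure (EuclideanSpace ℝ (Fin N × Fin d)))
      (_ : P₀ = P.map (ScoreTransformer.stack X h))
      (ε : ℝ) (_ : 0 < ε) (_ : ε < ScoreTransformer.eigMin Γ),
    ∃ (D L M : ℕ) (B : ℝ) (R : ℝ → ℝ),
    ∃ s ∈ ScoreTransformer.Transformer (d := d) e φ D L M B R,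
      (D : ℝ) ≤ C * (d + de) ∧
      (L : ℝ) ≤ C * (ScoreTransformer.condNumber (ScoreTransformer.diffusedCov Γ S t₀) *
        Real.log (N * d / (ε * ScoreTransformer.sigma t₀)) ^ 2) ∧
      (M : ℝ) ≤ C * max 1 ((ℓ * Real.posLog
        (N * d * ScoreTransformer.frob S / (ε * ScoreTransformer.sigma t₀))) ^ (1 / ν)) ∧
      B ≤ C * (Real.log (N * d / (ε * ScoreTransformer.sigma t₀)) *
        (ScoreTransformer.sigma t₀ ^ 2)⁻¹ * (N * d) * (r ^ 2 + ScoreTransformer.maxAbs S)) ∧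
      ∀ t ∈ Set.Icc t₀ T,
        0 ≤ R t ∧
        R t ≤ C * (Real.log (N * d / (ε * ScoreTransformer.sigma t₀)) *
          Real.sqrt (N * d) / ScoreTransformer.sigma t) ∧
        Integrable (fun x => ‖s t x - ScoreTransformer.score P₀ t x‖ ^ 2 *
          ScoreTransformer.diffusedDensity P₀ t x) ∧
        ∫ x, ‖s t x - ScoreTransformer.score P₀ t x‖ ^ 2 *
          ScoreTransformer.diffusedDensity P₀ t x ≤ ε / ScoreTransformer.sigma t ^ 2 := by
  have hwc := weightConst_nonneg (c := c) (Cμ := Cμ)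
  have hLμ : (0 : ℝ) ≤ Lμ := Nat.cast_nonneg _
  have hMμ : (0 : ℝ) ≤ Mμ := Nat.cast_nonneg _
  set C : ℝ := 14 + (4 * Lμ + 1200) + (Mμ + 4) + 32 + weightConst c Cμ with hC
  refine ⟨C, by positivity, ?_⟩
  intro N d de hN hd Ω _ P H X m γ S hX h _ e r ν ℓ hD hℓ t₀ T ht₀ _ Γ hΓ φ hφ hmean P₀ hP₀ ε
    hε hεΓ
  obtain ⟨hr, hsep, v, w, hv, hanti, hvr, hw, hw0, hw1, hslope, htrunc⟩ :=
    hD.exists_lag hc hN hℓ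
  have hN0 : Nonempty (Fin N) := ⟨⟨0, by omega⟩⟩
  have hNd : Nonempty (Fin N × Fin d) := ⟨⟨0, by omega⟩, ⟨0, by omega⟩⟩
  have hdiag : ∀ i, temporalMatrix γ h i i = 1 := fun i => by rw [hw, Nat.dist_self, hw0]
  have hS : S.PosSemidef := hX.posSemidef_spatial (h ⟨0, by omega⟩) (hdiag _)
  have hG : (Γ ⊗ₖ S).PosSemidef := hΓ ▸ hX.posSemidef_kronecker h
  have hΓh : Γ.IsHermitian := by
    ext i j
    rw [Matrix.conjTranspose_apply, star_trivial, hΓ, hw, hw, Nat.dist_comm]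
  have hΓ'h : ∀ J, (truncatedMatrix N w J).IsHermitian := fun J => by
    ext i j
    rw [Matrix.conjTranspose_apply, star_trivial, truncatedMatrix, Matrix.of_apply,
      Matrix.of_apply, Nat.dist_comm]
  -- The diagonal of `Γ` is `1`, so that `ε < λ_min(Γ) ≤ 1`.
  have hε1 : ε < 1 := by
    refine hεΓ.trans_le ?_
    have h1 := eigMin_mul_le hΓh (Pi.single (⟨0, by omega⟩ : Fin N) 1)
    simpa [hΓ, hdiag] using h1
  have hεx : ∀ x, ε * (x ⬝ᵥ x) ≤ x ⬝ᵥ Γ *ᵥ x := fun x =>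
    (mul_le_mul_of_nonneg_right hεΓ.le (Finset.sum_nonneg fun i _ =>
      mul_self_nonneg (x i))).trans (eigMin_mul_le hΓh x)
  have hN' : (2 : ℝ) ≤ N := by exact_mod_cast hN
  have hd' : (1 : ℝ) ≤ d := by exact_mod_cast hd
  have hn2 : (2 : ℝ) ≤ N * d := by nlinarith
  have hσ := sigma_pos ht₀
  have hσ2 := sigma_sq_lt_one ht₀
  have hσ1 : sigma t₀ < 1 := by nlinarith
  have hτ : 1 ≤ (sigma t₀ ^ 2)⁻¹ := (one_le_inv₀ (pow_pos hσ 2)).2 hσ2.le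
  set Λ := Real.log (N * d / (ε * sigma t₀)) with hΛdef
  have harg : (N * d : ℝ) / ε ≤ N * d / (ε * sigma t₀) := by
    gcongr
    nlinarith
  have harg2 : (2 : ℝ) ≤ N * d / ε := by
    rw [le_div_iff₀ hε]
    nlinarith
  have hΛ : Real.log 2 ≤ Λ := Real.log_le_log (by norm_num) (harg2.trans harg)
  have hΛn : (N * d : ℝ) / ε ≤ Real.exp Λ := by
    rw [hΛdef, Real.exp_log (by linarith)]
    exact harg
  have hΛ2 : 1 / 2 ≤ Λ := half_le_log_two.trans hΛ
  set κ := condNumber (diffusedCov Γ S t₀) with hκdef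
  have hκ : 1 ≤ κ := one_le_condNumber hG ht₀
  -- The cut-off lag; lags beyond `N - 1` do not occur.
  set J₀ := ⌈6 * Λ⌉₊ with hJ₀def
  have hJ₀ : 6 * Λ ≤ J₀ := Nat.le_ceil _
  have hJ₀1 : 1 ≤ J₀ := Nat.one_le_iff_ne_zero.2 (Nat.ceil_pos.2 (by linarith)).ne'
  set J := min J₀ (N - 1) with hJdef
  have hJN : J < N := by omega
  have hJle : (J : ℝ) ≤ 6 * Λ + 1 :=
    (Nat.cast_le.2 (min_le_left _ _)).trans (Nat.ceil_lt_add_one (by linarith)).le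
  -- The number of gradient steps.
  set K := ⌈80 * κ * Λ⌉₊ with hKdef
  have hKge : 80 * κ * Λ ≤ K := Nat.le_ceil _
  have hKle : (K : ℝ) ≤ 80 * κ * Λ + 1 := (Nat.ceil_lt_add_one (by positivity)).le
  obtain ⟨Q, hQ, hQN⟩ := exists_projection e
  obtain ⟨g, ⟨bs, hbsL, hbsB, hg⟩, hgμ⟩ := hmean
  have hs0 : 0 ≤ maxAbs S := Real.iSup_nonneg fun _ => abs_nonneg _
  obtain ⟨hB₁, hB₂, hB₃, hB₄, hB₅, hBμ⟩ := weight_bounds (Cμ := Cμ) hc hΛ2 hτ hN' hd' hr hs0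
    (Real.sqrt_nonneg _) (frob_le_maxAbs S) rfl
  set B := weightConst c Cμ * (Λ * (sigma t₀ ^ 2)⁻¹ * (N * d) * (r ^ 2 + maxAbs S)) with hBdef
  -- The self-attention gates realize products with factors up to `lam * c ^ 2 / 2 = σ₀⁻²`.
  set lam := 2 * (sigma t₀ ^ 2)⁻¹ / c ^ 2 with hlam
  have hlamc : lam * c ^ 2 / 2 = (sigma t₀ ^ 2)⁻¹ := by
    rw [hlam]
    field_simp
  have hlam0 : 0 ≤ lam := by positivity
  set R : ℝ → ℝ := fun t => 32 * (Λ * Real.sqrt (N * d) / sigma t) with hR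
  set ds : List (Block (Coord d de)) := descentBlocks Q S v w J lam (r ^ 2) K with hds
  have hdsB : ∀ b ∈ ds, b.Bounded 4 B := by
    refine descentBlocks_bounded (Real.sqrt_nonneg N) ?_ hlam0 (sq_nonneg r)
      (fun k hk => hvr k (by omega)) (hw1 J hJN) (fun k hk => hslope k (by omega))
      hB₁ hB₂ hB₃ hB₄ hB₅
    rwa [Real.sq_sqrt (Nat.cast_nonneg _)]
  refine ⟨Fintype.card (Coord d de), Lμ + (K * (J + 3) + 1), max Mμ 4, B, R,
    fun t x => clip (R t) (extract (runBlocks (bs ++ ds) (encode e (φ t) x))),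
    ⟨rfl, runBlocks (bs ++ ds), ⟨bs ++ ds, ?_, ?_, rfl⟩, fun _ _ => rfl⟩, ?_, ?_, ?_, ?_, ?_⟩
  · rw [List.length_append, hbsL, hds, descentBlocks_length]
  · intro b hb
    rcases List.mem_append.1 hb with hb | hb
    · exact (hbsB b hb).mono (le_max_left _ _) hBμ
    · exact (hdsB b hb).mono (le_max_right _ _) le_rfl
  · rw [card_coord]
    push_cast
    have h1 : (0 : ℝ) ≤ de := Nat.cast_nonneg _
    calc 9 * (d : ℝ) + de + 5 ≤ 14 * (d + de) := by linarith
      _ ≤ C * (d + de) := by gcongr; linarith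
  · refine (depth_le hΛ2 hκ hKle hJle).trans ?_
    gcongr
    linarith
  · -- The lags are spread over the depth, so that the number of heads is bounded by a constant.
    have h1 : ((max Mμ 4 : ℕ) : ℝ) ≤ Mμ + 4 := by
      rw [Nat.cast_max]
      exact max_le (by linarith) (by push_cast; linarith)
    refine h1.trans ((by linarith : (Mμ : ℝ) + 4 ≤ C).trans ?_)
    exact le_mul_of_one_le_right (by positivity) (le_max_left _ _)
  · rw [hBdef]
    gcongr
    linarith
  · intro t ht
    have ht0 : 0 < t := ht₀.trans_le ht.1
    have hσt := sigma_pos ht0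
    refine ⟨by positivity, ?_, ?_⟩
    · change 32 * (Λ * Real.sqrt (N * d) / sigma t) ≤ _
      gcongr
      linarith
    · rw [hP₀, hX.map_stack h, ← hΓ]
      refine integral_clip_descent_le (by omega) hd hG hS (hΓ'h J) hε hεx hΛ hΛn hJ₀
        (hΓ ▸ htrunc J₀ hJ₀1) ht₀ ht.1 hKge _ fun x => ?_
      set μ : EuclideanSpace ℝ (Fin N × Fin d) := WithLp.toLp 2 fun p => m (h p.1) p.2 with hμ
      have htok : tokens x e (φ t) (fun i p => if p.1 = 4 then m (h i) p.2 else 0) =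
          bufferTokens x e (φ t) ![0, 0, 0, 0, μ.ofLp] := by
        rw [bufferTokens]
        congr 1
        funext i p
        obtain ⟨k, a⟩ := p
        fin_cases k <;> simp [hμ]
      change clip (R t) (extract (runBlocks (bs ++ ds) (encode e (φ t) x))) = _
      rw [runBlocks_append, ← hg, hgμ t ht x, htok, hds, descentBlocks_eval hQ S hv hanti hJN hc.le
        hD.norm_eq hsep hlam0 (hlamc ▸ hτ) (φ := φ t)
        (fun k => hφ ▸ (timeFeature_bounds hG ht₀ ht.1 k).1)
        (fun k => hlamc ▸ hφ ▸ (timeFeature_bounds hG ht₀ ht.1 k).2) x μ K, hφ]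
      rfl
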